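/- Let $X=\mathbb R/\mathbb Z$ be the circle with normalized Lebesgue measure $m$. Let $\eta>0$ and let $(T_\delta)_{\delta\in[0,\eta)}$ be orientation preserving $C^3$ expanding maps of $X$ (that is, $T_\delta:X\to X$ is $C^3$ and $T_\delta'(x)>1$ for all $x\in X$), and suppose that the family is differentiable at $\delta=0$: there is $\epsilon\in C^3(X,\mathbb R)$ with $$T_\delta=T_0+\delta\epsilon+o_{C^3}(\delta)\qquad(\delta\to0^+),$$ where $o_{C^3}(\delta)$ is a term whose norm $\|r\|_{C^3}=\sup|r|+\sup|r'|+\sup|r''|+\sup|r'''|$ is $o(\delta)$. Let $W^{1,1}$ be the space of absolutely continuous functions on $X$ with norm $\|f\|_{W^{1,1}}=\int|f|\,dm+\int|f'|\,dm$, let $(L_\delta w)(x)=\sum_{y\in T_\delta^{-1}(x)}w(y)/|T_\delta'(y)|$ be the transfer operator of $T_\delta$, and for $w\in C^2(X,\mathbb R)$ put $$\hat Lw=-L_0\!\left(\frac{w\,\epsilon'}{T_0'}\right)-L_0\!\left(\frac{\epsilon\, w'}{T_0'}\right)+L_0\!\left(\frac{\epsilon\, T_0''}{(T_0')^2}\,w\right).$$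 Then every $T_\delta$ has exactly one invariant probability density $f_\delta$ in $W^{1,1}$; it belongs to $C^2(X,\mathbb R)$, in particular to $C^1(X,\mathbb R)$. The map $\delta\mapsto f_\delta$ is (right) differentiable at $\delta=0$ in $W^{1,1}$, with $$\lim_{\delta\to0^+}\left\|\frac{f_\delta-f_0}{\delta}-(1-L_0)^{-1}\hat Lf_0\right\|_{W^{1,1}}=0 .$$ Here $(1-L_0)^{-1}\hat Lf_0$ is an element $h\in W^{1,1}$ with $\int h\,dm=0$ and $(1-L_0)h=\hat Lf_0$, and it equals $\sum_{i\ge0}L_0^i\hat Lf_0$, the series converging in $W^{1,1}$. -/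

import Mathlib

open MeasureTheory Filter Topology Set

/-- The circle `X = ℝ / ℤ`; its `volume` is the normalized Lebesgue measure `m`. -/
abbrev X : Type := UnitAddCircle

namespace CircleMap

/-- The derivative of a real-valued function on the circle. -/
noncomputable def fderivX (f : X → ℝ) (x : X) : ℝ :=
  deriv (fun t : ℝ => f (x + (t : X))) 0

/-- `f ∈ C^n(X, ℝ)`. -/
def IsCk (n : ℕ) (f : X → ℝ) : Prop :=
  ContDiff ℝ n (fun t : ℝ => f (t : X))

/-- The `C^3` norm: the sum of the suprema of `|f|`, `|f'|`, `|f''|`, `|f'''|`. -/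
noncomputable def c3Norm (f : X → ℝ) : ℝ :=
  ∑ k ∈ Finset.range 4, ⨆ x : X, |fderivX^[k] f x|

/-- `f ∈ W^{1,1}`: `f` is absolutely continuous on the circle. -/
def IsW11 (f : X → ℝ) : Prop :=
  AbsolutelyContinuousOnInterval (fun t : ℝ => f (t : X)) 0 1

/-- The `W^{1,1}` norm `‖f‖_1 + ‖f'‖_1`. -/
noncomputable def w11Norm (f : X → ℝ) : ℝ :=
  (∫ x : X, |f x|) + ∫ x : X, |fderivX f x|

/-- `u a → f` in the normed space `W^{1,1}`, as `a` runs along the filter `l`. -/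
def TendstoW11 {ι : Type*} (u : ι → X → ℝ) (l : Filter ι) (f : X → ℝ) : Prop :=
  (∀ᶠ a in l, IsW11 (u a)) ∧ IsW11 f ∧
    Tendsto (fun a => w11Norm (fun x => u a x - f x)) l (𝓝 0)

/-- The derivative `T'(x)` of a circle map: the derivative at `t = 0` of the representative
in `(-1/2, 1/2]` of `T (x + t) - T x`. -/
noncomputable def mapDeriv (T : X → X) (x : X) : ℝ :=
  deriv (fun t : ℝ =>
    ((AddCircle.equivIoc (1 : ℝ) (-1 / 2) (T (x + (t : X)) - T x) : ℝ))) 0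

/-- `mapDeriv` is computed by any lift of the map. -/
theorem mapDeriv_of_lift {T : X → X} {F : ℝ → ℝ} (hF : ∀ t : ℝ, T (t : X) = (F t : X))
    (s : ℝ) (hc : ContinuousAt F s) : mapDeriv T (s : X) = deriv F s := by
  have h0 : Tendsto (fun t : ℝ => F (s + t) - F s) (𝓝 0) (𝓝 0) := by
    have h1 : Tendsto (fun t : ℝ => s + t) (𝓝 0) (𝓝 s) := by
      have : Tendsto (fun t : ℝ => s + t) (𝓝 0) (𝓝 (s + 0)) :=
        (continuous_const.add continuous_id).tendsto 0
      simpa using this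
    simpa using (hc.tendsto.comp h1).sub_const (F s)
  have hev : (fun t : ℝ =>
      ((AddCircle.equivIoc (1 : ℝ) (-1 / 2) (T ((s : X) + (t : X)) - T (s : X)) : ℝ)))
      =ᶠ[𝓝 0] fun t => F (s + t) - F s := by
    have hm : Ioo (-1 / 2 : ℝ) (1 / 2) ∈ 𝓝 (0 : ℝ) := Ioo_mem_nhds (by norm_num) (by norm_num)
    filter_upwards [h0 hm] with t ht
    have ht' : F (s + t) - F s ∈ Ioc (-1 / 2 : ℝ) (-1 / 2 + 1) :=
      ⟨ht.1, by have := ht.2; linarith⟩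
    have e : T ((s : X) + (t : X)) - T (s : X) = ((F (s + t) - F s : ℝ) : X) := by
      rw [← AddCircle.coe_add, hF, hF, AddCircle.coe_sub]
    rw [e]
    exact AddCircle.equivIoc_coe_of_mem ht'
  unfold mapDeriv
  rw [hev.deriv_eq, deriv_sub_const, deriv_comp_const_add, add_zero]

/-- A `C^3` orientation preserving expanding map of the circle: it has a `C^3` lift to `ℝ`,
and `T' > 1` everywhere. -/
structure IsExpandingC3 (T : X → X) : Prop where
  smooth : ∃ F : ℝ → ℝ, ContDiff ℝ 3 F ∧ ∀ t : ℝ, T (t : X) = (F t : X)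
  expanding : ∀ x : X, 1 < mapDeriv T x

/-- A family `T_δ`, `δ ∈ [0, η)`, of `C^3` expanding circle maps that is differentiable at `0`:
`T_δ = T_0 + δ ε + r_δ` modulo `1`, with `ε ∈ C^3` and `‖r_δ‖_{C^3} / δ → 0` as `δ → 0⁺`. -/
structure IsDifferentiableFamily (η : ℝ) (T : ℝ → X → X) (ε : X → ℝ) : Prop where
  expanding : ∀ δ ∈ Ico 0 η, IsExpandingC3 (T δ)
  smooth : IsCk 3 ε
  expansion : ∃ r : ℝ → X → ℝ,
    (∀ᶠ δ in 𝓝[>] (0 : ℝ), IsCk 3 (r δ) ∧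
      ∀ x : X, T δ x = T 0 x + ((δ * ε x + r δ x : ℝ) : X)) ∧
    Tendsto (fun δ => c3Norm (r δ) / δ) (𝓝[>] 0) (𝓝 0)

/-- The transfer operator `[L f](x) = ∑_{y ∈ T⁻¹(x)} f(y) / |T'(y)|`. -/
noncomputable def transfer (T : X → X) (f : X → ℝ) (x : X) : ℝ :=
  ∑ᶠ y ∈ T ⁻¹' {x}, f y / |mapDeriv T y|

/-- `f` is the density of a `T`-invariant probability measure `f m`, with `f ∈ W^{1,1}`. -/
structure IsInvariantDensity (T : X → X) (f : X → ℝ) : Prop where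
  w11 : IsW11 f
  nonneg : ∀ x, 0 ≤ f x
  integral_eq_one : ∫ x : X, f x = 1
  invariant : MeasurePreserving T
    ((volume : Measure X).withDensity fun x => ENNReal.ofReal (f x))
    ((volume : Measure X).withDensity fun x => ENNReal.ofReal (f x))

/-- The derivative operator
`L̂ w = - L_0 (w ε' / T_0') - L_0 (ε w' / T_0') + L_0 (ε T_0'' w / T_0'^2)`. -/
noncomputable def derivOp (T₀ : X → X) (ε w : X → ℝ) (x : X) : ℝ :=
  - transfer T₀ (fun y => w y * fderivX ε y / mapDeriv T₀ y) x
  - transfer T₀ (fun y => ε y * fderivX w y / mapDeriv T₀ y) x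
  + transfer T₀ (fun y => ε y * fderivX (mapDeriv T₀) y / mapDeriv T₀ y ^ 2 * w y) x

/-- `h = (1 - L)^{-1} g` on the space `V_s` of zero average functions in `W^{1,1}`:
`h ∈ V_s`, `(1 - L) h = g`, and `h = ∑_{i ≥ 0} L^i g` with convergence in `W^{1,1}`
(so that `h` is determined by `g`). -/
structure IsResolventAt (T : X → X) (g h : X → ℝ) : Prop where
  w11 : IsW11 h
  zero_average : ∫ x : X, h x = 0
  solves : ∀ x, h x - transfer T h x = g x
  neumann : TendstoW11
    (fun n : ℕ => fun x => ∑ i ∈ Finset.range n, (transfer T)^[i] g x) atTop h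

end CircleMap

/-!
The transfer operators of the lifts contract the cone `|f'| ≤ a f`: subtracting at every step a
fixed fraction of the mass keeps the iterates in the cone, so on functions of zero average the
iterates decay exponentially in `C¹`. Lifts that are close in `C²` share the cone and the rate, and
therefore a bound on `(1 - L_δ)⁻¹`. The same cone with second derivatives makes the invariant
density `C²`.

Moving mass along `ε` gives `L̂ w = -(L₀ (ε w))'`, which for `w ∈ C²` is the derivative of
`δ ↦ L_δ w` in `C¹`. The difference quotients `q_δ = (f_δ - f₀) / δ` solve
`(1 - L_δ) q_δ = (L_δ f₀ - L₀ f₀) / δ`. The right-hand side converges to `L̂ f₀` in `C¹`, and the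
uniform bound on `(1 - L_δ)⁻¹` yields `q_δ → (1 - L₀)⁻¹ L̂ f₀` in `C¹`, hence in `W^{1,1}`.
-/

namespace CircleMap

/-- `f` is a `1`-periodic function of class `C^k` on the line, that is, a `C^k` function on the
circle. -/
structure PeriodicCk (k : ℕ) (f : ℝ → ℝ) : Prop where
  contDiff : ContDiff ℝ k f
  periodic : Function.Periodic f 1

namespace PeriodicCk

variable {k : ℕ} {f g : ℝ → ℝ}

theorem add (hf : PeriodicCk k f) (hg : PeriodicCk k g) : PeriodicCk k (f + g) :=
  ⟨hf.contDiff.add hg.contDiff, hf.periodic.add hg.periodic⟩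

theorem sub (hf : PeriodicCk k f) (hg : PeriodicCk k g) : PeriodicCk k (f - g) :=
  ⟨hf.contDiff.sub hg.contDiff, hf.periodic.sub hg.periodic⟩

theorem neg (hf : PeriodicCk k f) : PeriodicCk k (-f) :=
  ⟨hf.contDiff.neg, fun t => congrArg Neg.neg (hf.periodic t)⟩

theorem mul (hf : PeriodicCk k f) (hg : PeriodicCk k g) : PeriodicCk k (f * g) :=
  ⟨hf.contDiff.mul hg.contDiff, hf.periodic.mul hg.periodic⟩

theorem const (c : ℝ) : PeriodicCk k (Function.const ℝ c) := ⟨contDiff_const, fun _ => rfl⟩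

theorem const_smul (c : ℝ) (hf : PeriodicCk k f) : PeriodicCk k (c • f) :=
  ⟨contDiff_const.smul hf.contDiff, hf.periodic.smul c⟩

theorem of_le {l : ℕ} (hf : PeriodicCk k f) (h : l ≤ k) : PeriodicCk l f :=
  ⟨hf.contDiff.of_le (by exact_mod_cast h), hf.periodic⟩

theorem continuous (hf : PeriodicCk k f) : Continuous f := hf.contDiff.continuous

theorem differentiable (hf : PeriodicCk (k + 1) f) : Differentiable ℝ f :=
  hf.contDiff.differentiable (by simp)

theorem deriv (hf : PeriodicCk (k + 1) f) : PeriodicCk k (deriv f) :=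
  ⟨ContDiff.deriv' (by exact_mod_cast hf.contDiff), fun t => by
    rw [← deriv_comp_add_const, funext hf.periodic]⟩

theorem iteratedDeriv {l : ℕ} (hf : PeriodicCk (k + l) f) : PeriodicCk k (iteratedDeriv l f) := by
  induction l generalizing k with
  | zero => rwa [iteratedDeriv_zero]
  | succ l ih => exact iteratedDeriv_succ (f := f) ▸ (ih (by rwa [add_assoc, add_comm 1])).deriv

theorem exists_abs_le (hf : PeriodicCk k f) : ∃ M, ∀ t, |f t| ≤ M := by
  obtain ⟨M, hM⟩ :=
    (hf.periodic.compact_of_continuous one_ne_zero hf.continuous).isBounded.exists_norm_le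
  exact ⟨M, fun t => hM _ (mem_range_self t)⟩

theorem uniformContinuous (hf : PeriodicCk k f) : UniformContinuous f := by
  have hlift : UniformContinuous hf.periodic.lift :=
    CompactSpace.uniformContinuous_of_continuous (hf.continuous.quotient_lift _)
  exact hlift.comp (uniformContinuous_of_continuousAt_zero (QuotientAddGroup.mk' _)
    (AddCircle.continuous_mk' 1).continuousAt)

theorem integral_deriv (hf : PeriodicCk (k + 1) f) :
    ∫ t in (0 : ℝ)..1, _root_.deriv f t = 0 := by
  rw [intervalIntegral.integral_deriv_eq_sub (fun t _ => hf.differentiable t)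
    (hf.deriv.continuous.intervalIntegrable 0 1), sub_eq_zero]
  simpa using hf.periodic 0

end PeriodicCk

/-- `F` is the lift to the line of a `C^3` expanding map of the circle of degree `d`. -/
structure ExpandingLift (d : ℕ) (F : ℝ → ℝ) : Prop where
  contDiff : ContDiff ℝ 3 F
  add_one : ∀ t, F (t + 1) = F t + d
  one_lt_deriv : ∀ t, 1 < deriv F t

/-- The inverse of a lift; the inverse branches of the circle map are `x ↦ invLift F (x + i)`. -/
noncomputable def invLift (F : ℝ → ℝ) : ℝ → ℝ := Function.invFun F

/-- The weight `1 / T'` of the transfer operator, in terms of a lift of `T`. -/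
noncomputable def weight (F : ℝ → ℝ) : ℝ → ℝ := (deriv F)⁻¹

/-- The sum over the inverse branches of a lift of degree `d`. -/
noncomputable def branchSum (d : ℕ) (F : ℝ → ℝ) : (ℝ → ℝ) →ₗ[ℝ] ℝ → ℝ :=
  ∑ i ∈ Finset.range d, LinearMap.funLeft ℝ ℝ fun x => invLift F (x + i)

/-- The transfer operator, acting on periodic functions on the line. -/
noncomputable def liftTransfer (d : ℕ) (F : ℝ → ℝ) : Module.End ℝ (ℝ → ℝ) :=
  branchSum d F ∘ₗ LinearMap.mulRight ℝ (weight F)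

section

variable {d : ℕ} {F φ ψ : ℝ → ℝ} {x : ℝ}

theorem branchSum_apply (d : ℕ) (F φ : ℝ → ℝ) (x : ℝ) :
    branchSum d F φ x = ∑ i ∈ Finset.range d, φ (invLift F (x + i)) := by
  simp [branchSum, LinearMap.funLeft_apply]

theorem liftTransfer_eq_branchSum (d : ℕ) (F f : ℝ → ℝ) :
    liftTransfer d F f = branchSum d F (f * weight F) := rfl

theorem branchSum_mono (h : ∀ t, φ t ≤ ψ t) : branchSum d F φ x ≤ branchSum d F ψ x := by
  simp only [branchSum_apply]
  exact Finset.sum_le_sum fun _ _ => h _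

theorem abs_branchSum_le (h : ∀ t, |φ t| ≤ ψ t) : |branchSum d F φ x| ≤ branchSum d F ψ x := by
  simp only [branchSum_apply]
  exact (Finset.abs_sum_le_sum_abs _ _).trans (Finset.sum_le_sum fun _ _ => h _)

end

namespace ExpandingLift

variable {d : ℕ} {F f φ ψ : ℝ → ℝ}

theorem differentiable (hF : ExpandingLift d F) : Differentiable ℝ F :=
  hF.contDiff.differentiable (by norm_num)

theorem deriv_pos (hF : ExpandingLift d F) (t : ℝ) : 0 < deriv F t :=
  one_pos.trans (hF.one_lt_deriv t)

theorem strictMono (hF : ExpandingLift d F) : StrictMono F := strictMono_of_deriv_pos hF.deriv_pos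

theorem monotone_sub_id (hF : ExpandingLift d F) : Monotone (F - id) :=
  monotone_of_deriv_nonneg (hF.differentiable.sub differentiable_id) fun t => by
    rw [deriv_sub (hF.differentiable t) differentiableAt_id, deriv_id, sub_nonneg]
    exact (hF.one_lt_deriv t).le

theorem surjective (hF : ExpandingLift d F) : Function.Surjective F := by
  refine hF.contDiff.continuous.surjective ?_ ?_
  · refine tendsto_atTop_mono' _ ?_ (tendsto_atTop_add_const_left _ (F 0) tendsto_id)
    filter_upwards [eventually_ge_atTop 0] with t ht
    simpa [le_sub_iff_add_le] using hF.monotone_sub_id ht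
  · refine tendsto_atBot_mono' _ ?_ (tendsto_atBot_add_const_left _ (F 0) tendsto_id)
    filter_upwards [eventually_le_atBot 0] with t ht
    simpa [sub_le_iff_le_add] using hF.monotone_sub_id ht

theorem apply_invLift (hF : ExpandingLift d F) (x : ℝ) : F (invLift F x) = x :=
  Function.rightInverse_invFun hF.surjective x

theorem invLift_apply (hF : ExpandingLift d F) (t : ℝ) : invLift F (F t) = t :=
  Function.leftInverse_invFun hF.strictMono.injective t

theorem invLift_add_degree (hF : ExpandingLift d F) (x : ℝ) :
    invLift F (x + d) = invLift F x + 1 := by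
  apply hF.strictMono.injective
  rw [hF.apply_invLift, hF.add_one, hF.apply_invLift]

theorem contDiff_invLift (hF : ExpandingLift d F) : ContDiff ℝ 3 (invLift F) := by
  let Φ : ℝ ≃ₜ ℝ := (hF.strictMono.orderIsoOfSurjective F hF.surjective).toHomeomorph
  have hsymm : invLift F = Φ.symm :=
    funext fun x => hF.strictMono.injective ((hF.apply_invLift x).trans (Φ.apply_symm_apply x).symm)
  rw [hsymm]
  exact Φ.contDiff_symm_deriv (fun t => (hF.deriv_pos t).ne')
    (fun t => (hF.differentiable t).hasDerivAt) hF.contDiff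

theorem continuous_invLift (hF : ExpandingLift d F) : Continuous (invLift F) :=
  hF.contDiff_invLift.continuous

theorem hasDerivAt_invLift (hF : ExpandingLift d F) (x : ℝ) :
    HasDerivAt (invLift F) (weight F (invLift F x)) x :=
  HasDerivAt.of_local_left_inverse hF.continuous_invLift.continuousAt
    (hF.differentiable _).hasDerivAt (hF.deriv_pos _).ne' (Eventually.of_forall hF.apply_invLift)

theorem degree_pos (hF : ExpandingLift d F) : 0 < d := by
  have h : F 0 < F (0 + 1) := hF.strictMono (by norm_num)
  rw [hF.add_one, lt_add_iff_pos_right] at h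
  exact_mod_cast h

theorem periodicCk_deriv (hF : ExpandingLift d F) : PeriodicCk 2 (deriv F) :=
  ⟨ContDiff.deriv' hF.contDiff, fun t => by
    rw [← deriv_comp_add_const, funext hF.add_one, deriv_add_const]⟩

theorem weight_pos (hF : ExpandingLift d F) (t : ℝ) : 0 < weight F t := inv_pos.2 (hF.deriv_pos t)

theorem weight_lt_one (hF : ExpandingLift d F) (t : ℝ) : weight F t < 1 :=
  inv_lt_one_of_one_lt₀ (hF.one_lt_deriv t)

theorem periodicCk_weight (hF : ExpandingLift d F) : PeriodicCk 2 (weight F) :=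
  ⟨hF.periodicCk_deriv.contDiff.inv fun t => (hF.deriv_pos t).ne',
    fun t => congrArg Inv.inv (hF.periodicCk_deriv.periodic t)⟩

theorem deriv_weight (hF : ExpandingLift d F) :
    deriv (weight F) = -(deriv (deriv F) * weight F ^ 2) := by
  ext t
  have h := ((hF.periodicCk_deriv.differentiable t).hasDerivAt.inv (hF.deriv_pos t).ne').deriv
  rw [weight, h]
  simp [div_eq_mul_inv]

theorem branchSum_periodic (hF : ExpandingLift d F) (hφ : Function.Periodic φ 1) :
    Function.Periodic (branchSum d F φ) 1 := fun x => by
  have hshift (i : ℕ) : φ (invLift F (x + 1 + i)) = φ (invLift F (x + (i + 1 : ℕ))) := by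
    push_cast; ring_nf
  have hcycle := (Finset.sum_range_succ (fun i : ℕ => φ (invLift F (x + i))) d).symm.trans
    (Finset.sum_range_succ' (fun i : ℕ => φ (invLift F (x + i))) d)
  rw [hF.invLift_add_degree, hφ, Nat.cast_zero, add_zero, add_left_inj] at hcycle
  simp only [branchSum_apply, hshift, hcycle]

theorem periodicCk_branchSum (hF : ExpandingLift d F) {k : ℕ} (hk : k ≤ 3)
    (hφ : PeriodicCk k φ) : PeriodicCk k (branchSum d F φ) := by
  refine ⟨?_, hF.branchSum_periodic hφ.periodic⟩
  simp only [funext (branchSum_apply d F φ)]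
  exact ContDiff.sum fun i _ => hφ.contDiff.comp
    ((hF.contDiff_invLift.of_le (by exact_mod_cast hk)).comp (contDiff_id.add contDiff_const))

theorem periodicCk_liftTransfer (hF : ExpandingLift d F) {k : ℕ} (hk : k ≤ 2)
    (hf : PeriodicCk k f) : PeriodicCk k (liftTransfer d F f) :=
  hF.periodicCk_branchSum (hk.trans (by norm_num)) (hf.mul (hF.periodicCk_weight.of_le hk))

theorem deriv_branchSum (hF : ExpandingLift d F) (hφ : Differentiable ℝ φ) :
    deriv (branchSum d F φ) = liftTransfer d F (deriv φ) := by
  ext x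
  rw [funext (branchSum_apply d F φ), liftTransfer_eq_branchSum, branchSum_apply]
  exact (HasDerivAt.fun_sum fun (i : ℕ) _ => (hφ _).hasDerivAt.comp x
    ((hF.hasDerivAt_invLift (x + i)).comp_add_const x i)).deriv

theorem deriv_liftTransfer (hF : ExpandingLift d F) (hf : Differentiable ℝ f) :
    deriv (liftTransfer d F f) = liftTransfer d F (deriv (f * weight F)) :=
  hF.deriv_branchSum (hf.mul hF.periodicCk_weight.differentiable)

theorem liftTransfer_mono (hF : ExpandingLift d F) {f g : ℝ → ℝ} (h : ∀ t, f t ≤ g t) (x : ℝ) :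
    liftTransfer d F f x ≤ liftTransfer d F g x :=
  branchSum_mono fun t => mul_le_mul_of_nonneg_right (h t) (hF.weight_pos t).le

theorem abs_liftTransfer_le (hF : ExpandingLift d F) {f g : ℝ → ℝ} (h : ∀ t, |f t| ≤ g t)
    (x : ℝ) : |liftTransfer d F f x| ≤ liftTransfer d F g x :=
  abs_branchSum_le fun t => by
    rw [LinearMap.mulRight_apply, Pi.mul_apply, abs_mul, abs_of_pos (hF.weight_pos t)]
    exact mul_le_mul_of_nonneg_right (h t) (hF.weight_pos t).le

/-! ### Duality -/

theorem integral_liftTransfer (hF : ExpandingLift d F) (hf : PeriodicCk 0 f) :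
    ∫ x in (0 : ℝ)..1, liftTransfer d F f x = ∫ t in (0 : ℝ)..1, f t := by
  let g : ℝ → ℝ := fun x => f (invLift F x) * weight F (invLift F x)
  have hg : Continuous g := (hf.mul (hF.periodicCk_weight.of_le (Nat.zero_le 2))).continuous.comp
    hF.continuous_invLift
  have hbranch (i : ℕ) : ∫ x in (0 : ℝ)..1, g (x + i) = ∫ x in (i : ℝ)..(i + 1 : ℕ), g x := by
    rw [intervalIntegral.integral_comp_add_right g]
    push_cast
    ring_nf
  calc ∫ x in (0 : ℝ)..1, liftTransfer d F f x
      = ∑ i ∈ Finset.range d, ∫ x in (0 : ℝ)..1, g (x + i) := by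
        have hint (i : ℕ) : IntervalIntegrable (fun x => g (x + i)) volume 0 1 :=
          (hg.comp (continuous_id.add continuous_const)).intervalIntegrable _ _
        rw [← intervalIntegral.integral_finsetSum fun i _ => hint i]
        exact intervalIntegral.integral_congr fun x _ => branchSum_apply d F _ x
    _ = ∫ x in (0 : ℝ)..d, g x := by
        simp only [hbranch]
        rw [intervalIntegral.sum_integral_adjacent_intervals fun i _ => hg.intervalIntegrable _ _,
          Nat.cast_zero]
    _ = ∫ t in invLift F 0..invLift F d, f t :=
        intervalIntegral.integral_comp_mul_deriv (fun x _ => hF.hasDerivAt_invLift x)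
          (hF.periodicCk_weight.continuous.comp hF.continuous_invLift).continuousOn hf.continuous
    _ = ∫ t in invLift F 0..invLift F 0 + 1, f t := by rw [← hF.invLift_add_degree, zero_add]
    _ = ∫ t in (0 : ℝ)..1, f t := by simpa using hf.periodic.intervalIntegral_add_eq _ 0

theorem mul_liftTransfer (hF : ExpandingLift d F) (hψ : Function.Periodic ψ 1) (f : ℝ → ℝ) :
    ψ * liftTransfer d F f = liftTransfer d F ((ψ ∘ F) * f) := by
  ext x
  have hψn (i : ℕ) : ψ (x + i) = ψ x := by simpa using hψ.nat_mul i x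
  simp [liftTransfer_eq_branchSum, branchSum_apply, Finset.mul_sum, hF.apply_invLift, hψn,
    mul_assoc]

theorem periodicCk_comp (hF : ExpandingLift d F) {k : ℕ} (hk : k ≤ 3) (hψ : PeriodicCk k ψ) :
    PeriodicCk k (ψ ∘ F) :=
  ⟨hψ.contDiff.comp (hF.contDiff.of_le (by exact_mod_cast hk)), fun t => by
    simpa [hF.add_one] using hψ.periodic.nat_mul d (F t)⟩

theorem integral_mul_liftTransfer (hF : ExpandingLift d F) (hψ : PeriodicCk 0 ψ)
    (hf : PeriodicCk 0 f) :
    ∫ x in (0 : ℝ)..1, ψ x * liftTransfer d F f x = ∫ t in (0 : ℝ)..1, ψ (F t) * f t := by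
  have h := hF.integral_liftTransfer ((hF.periodicCk_comp (Nat.zero_le 3) hψ).mul hf)
  rwa [← hF.mul_liftTransfer hψ.periodic] at h

end ExpandingLift

/-- All derivatives of `f` of order at most `k` are bounded by `M`: a bound on the `C^k` norm of
`f`, the norm being the largest of the suprema of the derivatives. -/
def CkBound (k : ℕ) (M : ℝ) (f : ℝ → ℝ) : Prop :=
  ∀ j ≤ k, ∀ t, |iteratedDeriv j f t| ≤ M

theorem PeriodicCk.exists_ckBound {k : ℕ} {f : ℝ → ℝ} (hf : PeriodicCk k f) :
    ∃ M, CkBound k M f := by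
  induction k with
  | zero =>
    obtain ⟨M, hM⟩ := hf.exists_abs_le
    exact ⟨M, fun j hj t => by simpa [Nat.le_zero.1 hj] using hM t⟩
  | succ k ih =>
    obtain ⟨M, hM⟩ := ih (hf.of_le k.le_succ)
    obtain ⟨N, hN⟩ := (PeriodicCk.iteratedDeriv (k := 0) (l := k + 1) (by simpa)).exists_abs_le
    refine ⟨max M N, fun j hj t => ?_⟩
    rcases Nat.le_succ_iff.1 hj with hj | rfl
    · exact (hM j hj t).trans (le_max_left _ _)
    · exact (hN t).trans (le_max_right _ _)

theorem ckBound_one_iff {f : ℝ → ℝ} {M : ℝ} :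
    CkBound 1 M f ↔ (∀ t, |f t| ≤ M) ∧ ∀ t, |deriv f t| ≤ M := by
  simp [CkBound, Nat.le_one_iff_eq_zero_or_eq_one]

namespace CkBound

variable {k : ℕ} {f g : ℝ → ℝ} {M N : ℝ}

theorem abs_le (hf : CkBound k M f) (t : ℝ) : |f t| ≤ M := by
  simpa using hf 0 (Nat.zero_le _) t

theorem nonneg (hf : CkBound k M f) : 0 ≤ M := (abs_nonneg _).trans (hf.abs_le 0)

theorem mono (hf : CkBound k M f) (h : M ≤ N) : CkBound k N f := fun j hj t =>
  (hf j hj t).trans h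

theorem add (hf : CkBound k M f) (hg : CkBound k N g) (hf' : ContDiff ℝ k f)
    (hg' : ContDiff ℝ k g) : CkBound k (M + N) (f + g) := fun j hj t => by
  have hjk : (j : WithTop ℕ∞) ≤ k := by exact_mod_cast hj
  rw [iteratedDeriv_add (hf'.of_le hjk).contDiffAt (hg'.of_le hjk).contDiffAt]
  exact (abs_add_le _ _).trans (add_le_add (hf j hj t) (hg j hj t))

theorem neg (hf : CkBound k M f) : CkBound k M (-f) := fun j hj t => by
  rw [iteratedDeriv_neg, abs_neg]
  exact hf j hj t

theorem sub (hf : CkBound k M f) (hg : CkBound k N g) (hf' : ContDiff ℝ k f)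
    (hg' : ContDiff ℝ k g) : CkBound k (M + N) (f - g) :=
  sub_eq_add_neg f g ▸ hf.add hg.neg hf' hg'.neg

theorem const_smul (c : ℝ) (hf : CkBound k M f) : CkBound k (|c| * M) (c • f) := fun j hj t => by
  rw [iteratedDeriv_const_smul_field, smul_eq_mul, abs_mul]
  exact mul_le_mul_of_nonneg_left (hf j hj t) (abs_nonneg c)

theorem norm_iteratedFDeriv_le (hf : CkBound k M f) {j : ℕ} (hj : j ≤ k) (t : ℝ) :
    ‖iteratedFDeriv ℝ j f t‖ ≤ M := by
  rw [norm_iteratedFDeriv_eq_norm_iteratedDeriv]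
  exact hf j hj t

section Series

variable {u : ℕ → ℝ → ℝ} {b : ℕ → ℝ}

theorem periodicCk_tsum (hu : ∀ i, CkBound k (b i) (u i)) (hu' : ∀ i, PeriodicCk k (u i))
    (hb : Summable b) : PeriodicCk k fun t => ∑' i, u i t :=
  ⟨contDiff_tsum (N := k) (v := fun _ => b) (fun i => (hu' i).contDiff) (fun _ _ => hb)
    fun j i t hj => (hu i).norm_iteratedFDeriv_le (by exact_mod_cast hj) t,
    fun t => tsum_congr fun i => (hu' i).periodic t⟩

theorem tsum (hu : ∀ i, CkBound k (b i) (u i)) (hu' : ∀ i, ContDiff ℝ k (u i))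
    (hb : Summable b) : CkBound k (∑' i, b i) fun t => ∑' i, u i t := fun j hj t => by
  rw [← Real.norm_eq_abs, ← norm_iteratedFDeriv_eq_norm_iteratedDeriv,
    iteratedFDeriv_tsum_apply (N := k) (v := fun _ => b) hu' (fun _ _ => hb)
      (fun j i t hj => (hu i).norm_iteratedFDeriv_le (by exact_mod_cast hj) t)
      (by exact_mod_cast hj)]
  exact tsum_of_norm_bounded hb.hasSum fun i => (hu i).norm_iteratedFDeriv_le hj t

end Series

end CkBound

/-- Convergence of `u` to `u₀` in the `C^k` norm. -/
def TendstoCk {ι : Type*} (k : ℕ) (u : ι → ℝ → ℝ) (l : Filter ι) (u₀ : ℝ → ℝ) : Prop :=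
  ∀ c > 0, ∀ᶠ i in l, CkBound k c (u i - u₀)

/-! ### The cone and its contraction -/

/-- The cone of `1`-periodic `C^k` functions with `|f^(j)| ≤ a^j f` for `j ≤ k`; in particular
its elements are nonnegative. -/
structure InCone (k : ℕ) (a : ℝ) (f : ℝ → ℝ) : Prop extends PeriodicCk k f where
  bound : ∀ j ≤ k, ∀ t, |iteratedDeriv j f t| ≤ a ^ j * f t

namespace InCone

variable {k : ℕ} {a : ℝ} {f : ℝ → ℝ}

theorem nonneg (hf : InCone k a f) (t : ℝ) : 0 ≤ f t :=
  (abs_nonneg _).trans (by simpa using hf.bound 0 (Nat.zero_le _) t)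

theorem abs_deriv_le (hf : InCone k a f) (hk : 1 ≤ k) (t : ℝ) : |deriv f t| ≤ a * f t := by
  simpa using hf.bound 1 hk t

theorem abs_deriv_deriv_le (hf : InCone k a f) (hk : 2 ≤ k) (t : ℝ) :
    |deriv (deriv f) t| ≤ a ^ 2 * f t := by
  simpa [iteratedDeriv_succ] using hf.bound 2 hk t

theorem monotone_mul_exp (hf : InCone k a f) (hk : 1 ≤ k) :
    Monotone fun t => f t * Real.exp (a * t) := by
  have hd (t : ℝ) : HasDerivAt (fun t => f t * Real.exp (a * t))
      (deriv f t * Real.exp (a * t) + f t * (Real.exp (a * t) * (a * 1))) t :=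
    ((hf.of_le hk).differentiable t).hasDerivAt.mul (((hasDerivAt_id t).const_mul a).exp)
  refine monotone_of_deriv_nonneg (fun t => (hd t).differentiableAt) fun t => ?_
  have hcone : 0 ≤ (deriv f t + a * f t) * Real.exp (a * t) :=
    mul_nonneg (by linarith [(abs_le.1 (hf.abs_deriv_le hk t)).1]) (Real.exp_pos _).le
  rw [(hd t).deriv]
  linarith

theorem le_exp_mul (hf : InCone k a f) (hk : 1 ≤ k) (ha : 0 ≤ a) (x y : ℝ) :
    f x ≤ Real.exp a * f y := by
  obtain ⟨z, ⟨hxz, hzx⟩, hzy⟩ := hf.periodic.exists_mem_Ico one_pos y x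
  rw [hzy]
  refine le_of_mul_le_mul_right ?_ (Real.exp_pos (a * x))
  calc f x * Real.exp (a * x) ≤ f z * Real.exp (a * z) := hf.monotone_mul_exp hk hxz
    _ ≤ f z * Real.exp (a + a * x) :=
        mul_le_mul_of_nonneg_left (Real.exp_le_exp.2 (by nlinarith)) (hf.nonneg z)
    _ = Real.exp a * f z * Real.exp (a * x) := by rw [Real.exp_add]; ring

theorem exp_neg_mul_integral_le (hf : InCone k a f) (hk : 1 ≤ k) (ha : 0 ≤ a) (t : ℝ) :
    Real.exp (-a) * ∫ x in (0 : ℝ)..1, f x ≤ f t := by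
  have h := intervalIntegral.integral_mono_on (μ := volume) zero_le_one
    (hf.continuous.intervalIntegrable 0 1)
    (intervalIntegrable_const (c := Real.exp a * f t)) fun x _ => hf.le_exp_mul hk ha x t
  rw [Real.exp_neg, inv_mul_le_iff₀ (Real.exp_pos a)]
  simpa using h

theorem le_exp_mul_integral (hf : InCone k a f) (hk : 1 ≤ k) (ha : 0 ≤ a) (t : ℝ) :
    f t ≤ Real.exp a * ∫ x in (0 : ℝ)..1, f x := by
  have h := intervalIntegral.integral_mono_on (μ := volume) zero_le_one
    (intervalIntegrable_const (c := f t)) ((hf.continuous.intervalIntegrable 0 1).const_mul _)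
    fun x _ => hf.le_exp_mul hk ha t x
  simpa using h

theorem ckBound (hf : InCone k a f) (hk : 1 ≤ k) (ha : 1 ≤ a) :
    CkBound k (a ^ k * (Real.exp a * ∫ x in (0 : ℝ)..1, f x)) f := fun j hj t =>
  have ha0 : 0 ≤ a := zero_le_one.trans ha
  (hf.bound j hj t).trans (mul_le_mul (pow_le_pow_right₀ ha hj)
    (hf.le_exp_mul_integral hk ha0 t) (hf.nonneg t) (pow_nonneg ha0 _))

theorem add_const {c : ℝ} (hf : PeriodicCk k f) (hc : ∀ t, 0 ≤ f t + c)
    (hb : ∀ j, 1 ≤ j → j ≤ k → ∀ t, |iteratedDeriv j f t| ≤ a ^ j * (f t + c)) :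
    InCone k a (f + Function.const ℝ c) := by
  refine ⟨hf.add (.const c), fun j hj t => ?_⟩
  rcases Nat.eq_zero_or_pos j with rfl | hj0
  · simp [abs_of_nonneg (hc t)]
  · have hjk : (j : WithTop ℕ∞) ≤ k := by exact_mod_cast hj
    have hconst : iteratedDeriv j (Function.const ℝ c) t = 0 :=
      iteratedDeriv_const.trans (if_neg hj0.ne')
    rw [iteratedDeriv_add (g := Function.const ℝ c) (hf.contDiff.of_le hjk).contDiffAt
      contDiffAt_const, hconst, add_zero]
    exact hb j hj0 hj t

theorem const {c : ℝ} (hc : 0 ≤ c) (ha : 0 ≤ a) : InCone k a (Function.const ℝ c) := by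
  have h := add_const (k := k) (a := a) (c := c) (.const 0) (fun _ => by simpa using hc)
    fun j _ _ t => by
      simpa [Function.const_def, iteratedDeriv_const] using mul_nonneg (pow_nonneg ha j) hc
  rwa [Function.const_zero, zero_add] at h

end InCone

/-- `F` is an expanding lift whose transfer operator maps the cone of parameters `k`, `a` into the
smaller cone whose derivative bounds are `κ` times as large. -/
structure StrictCone (k d : ℕ) (a κ : ℝ) (F : ℝ → ℝ) : Prop extends ExpandingLift d F where
  one_le : 1 ≤ k
  le_two : k ≤ 2
  one_le_a : 1 ≤ a
  κ_nonneg : 0 ≤ κ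
  κ_lt_one : κ < 1
  strict : ∀ f, InCone k a f → ∀ j, 1 ≤ j → j ≤ k → ∀ t,
    |iteratedDeriv j (liftTransfer d F f) t| ≤ κ * a ^ j * liftTransfer d F f t

/-- The fraction of the mass of `f` that can be subtracted from `L f` without leaving the cone. -/
noncomputable def coneGap (a κ : ℝ) : ℝ := (1 - κ) * Real.exp (-a)

/-- The constant in the exponential decay of the transfer operator on functions of zero average. -/
noncomputable def decayConst (k : ℕ) (a : ℝ) : ℝ := 4 * a ^ k * Real.exp a

/-- The transfer operator followed by the removal of the fraction `c` of the mass. On functions of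
zero average it is the transfer operator. -/
noncomputable def dampedTransfer (c : ℝ) (d : ℕ) (F f : ℝ → ℝ) : ℝ → ℝ :=
  liftTransfer d F f - Function.const ℝ (c * ∫ x in (0 : ℝ)..1, f x)

/-- The Neumann series `∑ Lⁿ g`, taken pointwise. -/
noncomputable def neumannSeries (d : ℕ) (F g : ℝ → ℝ) (t : ℝ) : ℝ :=
  ∑' n : ℕ, (liftTransfer d F ^ n) g t

namespace ExpandingLift

variable {d k : ℕ} {F f g : ℝ → ℝ}

theorem periodicCk_liftTransfer_pow (hF : ExpandingLift d F) (hk : k ≤ 2) (hf : PeriodicCk k f)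
    (n : ℕ) : PeriodicCk k ((liftTransfer d F ^ n) f) := by
  induction n with
  | zero => exact hf
  | succ n ih => rw [pow_succ']; exact hF.periodicCk_liftTransfer hk ih

theorem integral_liftTransfer_pow (hF : ExpandingLift d F) (hf : PeriodicCk 0 f) (n : ℕ) :
    ∫ t in (0 : ℝ)..1, (liftTransfer d F ^ n) f t = ∫ t in (0 : ℝ)..1, f t := by
  induction n with
  | zero => rfl
  | succ n ih =>
    rw [pow_succ', ← ih]
    exact hF.integral_liftTransfer (hF.periodicCk_liftTransfer_pow (Nat.zero_le 2) hf n)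

theorem integral_sub_liftTransfer (hF : ExpandingLift d F) (hf : PeriodicCk 0 f) :
    ∫ t in (0 : ℝ)..1, (f - liftTransfer d F f) t = 0 := by
  have hL := hF.periodicCk_liftTransfer (Nat.zero_le 2) hf
  simp only [Pi.sub_apply]
  rw [intervalIntegral.integral_sub (hf.continuous.intervalIntegrable _ _)
    (hL.continuous.intervalIntegrable _ _), hF.integral_liftTransfer hf, sub_self]

variable {c : ℝ}

theorem periodicCk_dampedTransfer_iterate (hF : ExpandingLift d F) (hk : k ≤ 2)
    (hf : PeriodicCk k f) (n : ℕ) : PeriodicCk k ((dampedTransfer c d F)^[n] f) := by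
  induction n with
  | zero => exact hf
  | succ n ih =>
    rw [Function.iterate_succ_apply']
    exact (hF.periodicCk_liftTransfer hk ih).sub (.const _)

theorem integral_dampedTransfer_iterate (hF : ExpandingLift d F) (hf : PeriodicCk 0 f) (n : ℕ) :
    ∫ t in (0 : ℝ)..1, (dampedTransfer c d F)^[n] f t
      = (1 - c) ^ n * ∫ t in (0 : ℝ)..1, f t := by
  induction n with
  | zero => simp
  | succ n ih =>
    have hn := hF.periodicCk_dampedTransfer_iterate (c := c) (Nat.zero_le 2) hf n
    have hL := hF.periodicCk_liftTransfer (Nat.zero_le 2) hn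
    simp only [Function.iterate_succ_apply']
    rw [dampedTransfer, ih]
    simp only [Pi.sub_apply, Function.const_apply]
    rw [intervalIntegral.integral_sub (hL.continuous.intervalIntegrable _ _)
      intervalIntegrable_const, hF.integral_liftTransfer hn]
    simp only [ih, intervalIntegral.integral_const, sub_zero, one_smul]
    ring

theorem dampedTransfer_iterate_sub (hF : ExpandingLift d F) (hf : PeriodicCk 0 f)
    (hg : PeriodicCk 0 g) (hfg : ∫ t in (0 : ℝ)..1, f t = ∫ t in (0 : ℝ)..1, g t) (n : ℕ) :
    (dampedTransfer c d F)^[n] f - (dampedTransfer c d F)^[n] g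
      = (liftTransfer d F ^ n) (f - g) := by
  induction n with
  | zero => rfl
  | succ n ih =>
    have hmass : ∫ t in (0 : ℝ)..1, (dampedTransfer c d F)^[n] f t
        = ∫ t in (0 : ℝ)..1, (dampedTransfer c d F)^[n] g t := by
      rw [hF.integral_dampedTransfer_iterate hf, hF.integral_dampedTransfer_iterate hg, hfg]
    rw [Function.iterate_succ_apply', Function.iterate_succ_apply', dampedTransfer, hmass,
      dampedTransfer, sub_sub_sub_cancel_right, ← map_sub, ih, pow_succ', Module.End.mul_apply]

end ExpandingLift

namespace StrictCone

variable {k d : ℕ} {a κ M : ℝ} {F f g v : ℝ → ℝ}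

theorem a_nonneg (h : StrictCone k d a κ F) : 0 ≤ a := zero_le_one.trans h.one_le_a

theorem coneGap_pos (h : StrictCone k d a κ F) : 0 < coneGap a κ :=
  mul_pos (sub_pos.2 h.κ_lt_one) (Real.exp_pos _)

theorem coneGap_le_one (h : StrictCone k d a κ F) : coneGap a κ ≤ 1 :=
  mul_le_one₀ (by linarith [h.κ_nonneg]) (Real.exp_pos _).le
    (Real.exp_le_one_iff.2 (by linarith [h.a_nonneg]))

theorem inCone_liftTransfer (h : StrictCone k d a κ F) (hf : InCone k a f) :
    InCone k a (liftTransfer d F f) := by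
  have hn (t : ℝ) : 0 ≤ liftTransfer d F f t :=
    (abs_nonneg _).trans (h.abs_liftTransfer_le (fun t => (abs_of_nonneg (hf.nonneg t)).le) t)
  refine ⟨h.periodicCk_liftTransfer h.le_two hf.toPeriodicCk, fun j hj t => ?_⟩
  rcases Nat.eq_zero_or_pos j with rfl | hj0
  · simp [abs_of_nonneg (hn t)]
  · exact (h.strict f hf j hj0 hj t).trans (mul_le_mul_of_nonneg_right
      (mul_le_of_le_one_left (pow_nonneg h.a_nonneg j) h.κ_lt_one.le) (hn t))

theorem inCone_liftTransfer_pow (h : StrictCone k d a κ F) (hf : InCone k a f) (n : ℕ) :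
    InCone k a ((liftTransfer d F ^ n) f) := by
  induction n with
  | zero => exact hf
  | succ n ih => rw [pow_succ']; exact h.inCone_liftTransfer ih

theorem coneGap_mul_integral_le (h : StrictCone k d a κ F) (hf : InCone k a f) (t : ℝ) :
    coneGap a κ * ∫ x in (0 : ℝ)..1, f x ≤ (1 - κ) * liftTransfer d F f t := by
  have hL := (h.inCone_liftTransfer hf).exp_neg_mul_integral_le h.one_le h.a_nonneg t
  rw [h.integral_liftTransfer (hf.of_le (Nat.zero_le k))] at hL
  rw [coneGap, mul_assoc]
  exact mul_le_mul_of_nonneg_left hL (sub_nonneg.2 h.κ_lt_one.le)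

theorem inCone_dampedTransfer (h : StrictCone k d a κ F) (hf : InCone k a f) :
    InCone k a (dampedTransfer (coneGap a κ) d F f) := by
  have hL := h.inCone_liftTransfer hf
  have hgap := h.coneGap_mul_integral_le hf
  have hadd : dampedTransfer (coneGap a κ) d F f
      = liftTransfer d F f + Function.const ℝ (-(coneGap a κ * ∫ x in (0 : ℝ)..1, f x)) :=
    sub_eq_add_neg _ _
  rw [hadd]
  refine InCone.add_const hL.toPeriodicCk (fun t => ?_) fun j hj0 hj t => ?_
  · linarith [hgap t, mul_nonneg h.κ_nonneg (hL.nonneg t)]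
  · calc |iteratedDeriv j (liftTransfer d F f) t| ≤ κ * a ^ j * liftTransfer d F f t :=
          h.strict f hf j hj0 hj t
      _ = a ^ j * (κ * liftTransfer d F f t) := by ring
      _ ≤ _ := mul_le_mul_of_nonneg_left (by linarith [hgap t]) (pow_nonneg h.a_nonneg j)

theorem inCone_dampedTransfer_iterate (h : StrictCone k d a κ F) (hf : InCone k a f) (n : ℕ) :
    InCone k a ((dampedTransfer (coneGap a κ) d F)^[n] f) := by
  induction n with
  | zero => exact hf
  | succ n ih => rw [Function.iterate_succ_apply']; exact h.inCone_dampedTransfer ih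

theorem ckBound_dampedTransfer_iterate (h : StrictCone k d a κ F) (hf : InCone k a f) (n : ℕ) :
    CkBound k (a ^ k * (Real.exp a * ((1 - coneGap a κ) ^ n * ∫ t in (0 : ℝ)..1, f t)))
      ((dampedTransfer (coneGap a κ) d F)^[n] f) := by
  rw [← h.integral_dampedTransfer_iterate (hf.of_le (Nat.zero_le k))]
  exact (h.inCone_dampedTransfer_iterate hf n).ckBound h.one_le h.one_le_a

theorem inCone_add_const_of_ckBound (h : StrictCone k d a κ F) (hg : PeriodicCk k g)
    (hM : CkBound k M g) : InCone k a (g + Function.const ℝ (2 * M)) := by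
  have hle (t : ℝ) : M ≤ g t + 2 * M := by linarith [(abs_le.1 (hM.abs_le t)).1]
  have hnonneg (t : ℝ) : 0 ≤ g t + 2 * M := hM.nonneg.trans (hle t)
  exact InCone.add_const hg hnonneg fun j _ hj t => ((hM j hj t).trans (hle t)).trans
    (le_mul_of_one_le_left (hnonneg t) (one_le_pow₀ h.one_le_a))

theorem ckBound_liftTransfer_pow (h : StrictCone k d a κ F) (hg : PeriodicCk k g)
    (hg0 : ∫ t in (0 : ℝ)..1, g t = 0) (hM : CkBound k M g) (n : ℕ) :
    CkBound k (decayConst k a * M * (1 - coneGap a κ) ^ n) ((liftTransfer d F ^ n) g) := by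
  have hc : InCone k a (Function.const ℝ (2 * M)) :=
    InCone.const (mul_nonneg zero_le_two hM.nonneg) h.a_nonneg
  have hgc := h.inCone_add_const_of_ckBound hg hM
  have hc_mass : ∫ t in (0 : ℝ)..1, Function.const ℝ (2 * M) t = 2 * M := by simp
  have hgc_mass : ∫ t in (0 : ℝ)..1, (g + Function.const ℝ (2 * M)) t = 2 * M := by
    simp only [Pi.add_apply, Function.const_apply] at hc_mass ⊢
    rw [intervalIntegral.integral_add (hg.continuous.intervalIntegrable _ _)
      intervalIntegrable_const, hg0, hc_mass, zero_add]
  have hsplit := h.dampedTransfer_iterate_sub (c := coneGap a κ) (hgc.of_le (Nat.zero_le k))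
    (hc.of_le (Nat.zero_le k)) (hgc_mass.trans hc_mass.symm) n
  rw [add_sub_cancel_right] at hsplit
  have hbound := (h.ckBound_dampedTransfer_iterate hgc n).sub
    (h.ckBound_dampedTransfer_iterate hc n)
    (h.periodicCk_dampedTransfer_iterate h.le_two hgc.toPeriodicCk n).contDiff
    (h.periodicCk_dampedTransfer_iterate h.le_two hc.toPeriodicCk n).contDiff
  rw [hsplit, hgc_mass, hc_mass] at hbound
  convert hbound using 1
  rw [decayConst]
  ring

/-! ### The Neumann series -/

theorem hasSum_decay (h : StrictCone k d a κ F) (C : ℝ) :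
    HasSum (fun n => C * (1 - coneGap a κ) ^ n) (C / coneGap a κ) := by
  have hgeom := (hasSum_geometric_of_lt_one (sub_nonneg.2 h.coneGap_le_one)
    (sub_lt_self 1 h.coneGap_pos)).mul_left C
  rwa [sub_sub_cancel, ← div_eq_mul_inv] at hgeom

theorem tendsto_decay (h : StrictCone k d a κ F) (C : ℝ) :
    Tendsto (fun n => C * (1 - coneGap a κ) ^ n) atTop (𝓝 0) :=
  (h.hasSum_decay C).summable.tendsto_atTop_zero

theorem summable_liftTransfer_pow (h : StrictCone k d a κ F) (hg : PeriodicCk k g)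
    (hg0 : ∫ t in (0 : ℝ)..1, g t = 0) (t : ℝ) :
    Summable fun n => (liftTransfer d F ^ n) g t := by
  obtain ⟨M, hM⟩ := hg.exists_ckBound
  exact .of_norm_bounded (h.hasSum_decay (decayConst k a * M)).summable fun n =>
    (h.ckBound_liftTransfer_pow hg hg0 hM n).abs_le t

theorem periodicCk_neumannSeries (h : StrictCone k d a κ F) (hg : PeriodicCk k g)
    (hg0 : ∫ t in (0 : ℝ)..1, g t = 0) : PeriodicCk k (neumannSeries d F g) := by
  obtain ⟨M, hM⟩ := hg.exists_ckBound
  exact CkBound.periodicCk_tsum (h.ckBound_liftTransfer_pow hg hg0 hM)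
    (h.periodicCk_liftTransfer_pow h.le_two hg) (h.hasSum_decay _).summable

theorem ckBound_neumannSeries (h : StrictCone k d a κ F) (hg : PeriodicCk k g)
    (hg0 : ∫ t in (0 : ℝ)..1, g t = 0) (hM : CkBound k M g) :
    CkBound k (decayConst k a * M / coneGap a κ) (neumannSeries d F g) := by
  rw [← (h.hasSum_decay _).tsum_eq]
  exact CkBound.tsum (h.ckBound_liftTransfer_pow hg hg0 hM)
    (fun n => (h.periodicCk_liftTransfer_pow h.le_two hg n).contDiff) (h.hasSum_decay _).summable

theorem integral_neumannSeries (h : StrictCone k d a κ F) (hg : PeriodicCk k g)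
    (hg0 : ∫ t in (0 : ℝ)..1, g t = 0) : ∫ t in (0 : ℝ)..1, neumannSeries d F g t = 0 := by
  obtain ⟨M, hM⟩ := hg.exists_ckBound
  have hsum := intervalIntegral.hasSum_integral_of_dominated_convergence
    (μ := volume) (a := 0) (b := 1) (f := neumannSeries d F g)
    (fun n _ => decayConst k a * M * (1 - coneGap a κ) ^ n)
    (fun n => (h.periodicCk_liftTransfer_pow h.le_two hg n).continuous.aestronglyMeasurable)
    (fun n => .of_forall fun t _ => (h.ckBound_liftTransfer_pow hg hg0 hM n).abs_le t)
    (.of_forall fun t _ => (h.hasSum_decay _).summable) intervalIntegrable_const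
    (.of_forall fun t _ => (h.summable_liftTransfer_pow hg hg0 t).hasSum)
  simp only [h.integral_liftTransfer_pow (hg.of_le (Nat.zero_le k)), hg0] at hsum
  exact hsum.unique hasSum_zero

theorem neumannSeries_sub_sum (h : StrictCone k d a κ F) (hg : PeriodicCk k g)
    (hg0 : ∫ t in (0 : ℝ)..1, g t = 0) (n : ℕ) :
    neumannSeries d F g - ∑ i ∈ Finset.range n, (liftTransfer d F ^ i) g
      = neumannSeries d F ((liftTransfer d F ^ n) g) := by
  ext t
  have hsum := (h.summable_liftTransfer_pow hg hg0 t).sum_add_tsum_nat_add n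
  simp only [pow_add, Module.End.mul_apply] at hsum
  rw [Pi.sub_apply, Finset.sum_apply, neumannSeries, neumannSeries, ← hsum, add_sub_cancel_left]

theorem tendstoCk_neumannSeries (h : StrictCone k d a κ F) (hg : PeriodicCk k g)
    (hg0 : ∫ t in (0 : ℝ)..1, g t = 0) :
    TendstoCk k (fun n => ∑ i ∈ Finset.range n, (liftTransfer d F ^ i) g) atTop
      (neumannSeries d F g) := by
  intro c hc
  obtain ⟨M, hM⟩ := hg.exists_ckBound
  have hsmall := ((h.tendsto_decay (decayConst k a * M)).const_mul (decayConst k a)).div_const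
    (coneGap a κ)
  rw [mul_zero, zero_div] at hsmall
  filter_upwards [hsmall.eventually_le_const hc] with n hn
  rw [← neg_sub, h.neumannSeries_sub_sum hg hg0]
  exact ((h.ckBound_neumannSeries (h.periodicCk_liftTransfer_pow h.le_two hg n)
    ((h.integral_liftTransfer_pow (hg.of_le k.zero_le) n).trans hg0)
    (h.ckBound_liftTransfer_pow hg hg0 hM n)).mono hn).neg

theorem liftTransfer_neumannSeries (h : StrictCone k d a κ F) (hg : PeriodicCk k g)
    (hg0 : ∫ t in (0 : ℝ)..1, g t = 0) :
    liftTransfer d F (neumannSeries d F g) = neumannSeries d F (liftTransfer d F g) := by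
  ext x
  simp only [liftTransfer_eq_branchSum, branchSum_apply, neumannSeries, Pi.mul_apply,
    ← tsum_mul_right]
  rw [← Summable.tsum_finsetSum fun i _ =>
    (h.summable_liftTransfer_pow hg hg0 _).mul_right _]
  refine tsum_congr fun n => ?_
  rw [← liftTransfer_eq_branchSum, ← Module.End.mul_apply, ← pow_succ, pow_succ',
    Module.End.mul_apply, liftTransfer_eq_branchSum, branchSum_apply]
  rfl

theorem neumannSeries_sub_liftTransfer (h : StrictCone k d a κ F) (hg : PeriodicCk k g)
    (hg0 : ∫ t in (0 : ℝ)..1, g t = 0) :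
    neumannSeries d F g - liftTransfer d F (neumannSeries d F g) = g := by
  have hsum := h.neumannSeries_sub_sum hg hg0 1
  rw [Finset.sum_range_one, pow_zero, pow_one, Module.End.one_apply] at hsum
  rw [h.liftTransfer_neumannSeries hg hg0, ← hsum, sub_sub_cancel]

theorem tendsto_liftTransfer_pow (h : StrictCone k d a κ F) (hv : PeriodicCk k v) (t : ℝ) :
    Tendsto (fun n => (liftTransfer d F ^ n) v t) atTop
      (𝓝 (v t - neumannSeries d F (v - liftTransfer d F v) t)) := by
  have hpartial (n : ℕ) : ∑ i ∈ Finset.range n, (liftTransfer d F ^ i) (v - liftTransfer d F v) t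
      = v t - (liftTransfer d F ^ n) v t := by
    have hgeom := congrFun (LinearMap.congr_fun (geom_sum_mul_neg (liftTransfer d F) n) v) t
    simpa [LinearMap.sum_apply, Finset.sum_apply] using hgeom
  have hlim := ((h.summable_liftTransfer_pow (hv.sub (h.periodicCk_liftTransfer h.le_two hv))
    (h.integral_sub_liftTransfer (hv.of_le (Nat.zero_le k))) t).hasSum.tendsto_sum_nat).const_sub
      (v t)
  simp only [hpartial, sub_sub_cancel] at hlim
  exact hlim

theorem neumannSeries_of_sub_liftTransfer (h : StrictCone k d a κ F) (hv : PeriodicCk k v)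
    (hv0 : ∫ t in (0 : ℝ)..1, v t = 0) :
    neumannSeries d F (v - liftTransfer d F v) = v := by
  obtain ⟨M, hM⟩ := hv.exists_ckBound
  ext t
  have hpow : Tendsto (fun n => (liftTransfer d F ^ n) v t) atTop (𝓝 0) :=
    squeeze_zero_norm (fun n => (h.ckBound_liftTransfer_pow hv hv0 hM n).abs_le t)
      (h.tendsto_decay _)
  exact (sub_eq_zero.1 (tendsto_nhds_unique (h.tendsto_liftTransfer_pow hv t) hpow)).symm

theorem ckBound_of_sub_liftTransfer (h : StrictCone k d a κ F) (hv : PeriodicCk k v)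
    (hv0 : ∫ t in (0 : ℝ)..1, v t = 0) (hM : CkBound k M (v - liftTransfer d F v)) :
    CkBound k (decayConst k a * M / coneGap a κ) v := by
  rw [← h.neumannSeries_of_sub_liftTransfer hv hv0]
  exact h.ckBound_neumannSeries (hv.sub (h.periodicCk_liftTransfer h.le_two hv))
    (h.integral_sub_liftTransfer (hv.of_le (Nat.zero_le k))) hM

end StrictCone

theorem tendstoCk_zero_of_sub_liftTransfer {ι : Type*} {l : Filter ι} {k d : ℕ} {a κ : ℝ}
    {F w : ι → ℝ → ℝ} (hF : ∀ᶠ i in l, StrictCone k d a κ (F i))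
    (hw : ∀ᶠ i in l, PeriodicCk k (w i) ∧ ∫ t in (0 : ℝ)..1, w i t = 0)
    (h : TendstoCk k (fun i => w i - liftTransfer d (F i) (w i)) l 0) : TendstoCk k w l 0 := by
  intro c hc
  have hsmall : Tendsto (fun M => decayConst k a * M / coneGap a κ) (𝓝[>] 0) (𝓝 0) := by
    have hcont : Continuous fun M => decayConst k a * M / coneGap a κ := by fun_prop
    simpa using (hcont.tendsto 0).mono_left nhdsWithin_le_nhds
  obtain ⟨M, hMc, hM⟩ := ((hsmall.eventually_le_const hc).and self_mem_nhdsWithin).exists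
  filter_upwards [hF, hw, h M hM] with i hi ⟨hwi, hwi0⟩ hb
  rw [sub_zero] at hb ⊢
  exact (hi.ckBound_of_sub_liftTransfer hwi hwi0 hb).mono hMc

/-! ### Expanding maps contract a cone -/

section

variable {k : ℕ} {a θ K : ℝ} {f w : ℝ → ℝ}

theorem InCone.abs_deriv_mul_le (hf : InCone k a f) (hk : 1 ≤ k) (hw : Differentiable ℝ w)
    (hw0 : ∀ t, 0 ≤ w t) (hθ : ∀ t, w t ≤ θ) (hK : CkBound 1 K w) (t : ℝ) :
    |deriv (f * w) t| ≤ (θ * a + K) * f t := by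
  rw [deriv_mul ((hf.of_le hk).differentiable t) (hw t)]
  have hf1 := hf.abs_deriv_le hk t
  calc |deriv f t * w t + f t * deriv w t| ≤ |deriv f t| * w t + f t * |deriv w t| := by
        refine (abs_add_le _ _).trans_eq ?_
        rw [abs_mul, abs_mul, abs_of_nonneg (hw0 t), abs_of_nonneg (hf.nonneg t)]
    _ ≤ a * f t * θ + f t * K := by
        have := (abs_nonneg _).trans hf1
        gcongr
        exacts [hw0 t, hθ t, hf.nonneg t, (ckBound_one_iff.1 hK).2 t]
    _ = (θ * a + K) * f t := by ring

theorem InCone.abs_deriv_deriv_mul_mul_le (hf : InCone 2 a f) (ha : 1 ≤ a) (hw : ContDiff ℝ 2 w)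
    (hw0 : ∀ t, 0 ≤ w t) (hθ : ∀ t, w t ≤ θ) (hθ1 : θ ≤ 1) (hK : CkBound 2 K w) (t : ℝ) :
    |deriv (deriv (f * w) * w) t| ≤ (θ * a ^ 2 + (4 * K + K ^ 2) * a) * f t := by
  have hdw : Differentiable ℝ w := hw.differentiable (by norm_num)
  have hdw' : Differentiable ℝ (deriv w) :=
    ContDiff.differentiable (n := 1) (ContDiff.deriv' hw) one_ne_zero
  have hdf : Differentiable ℝ f := (hf.of_le one_le_two).differentiable
  have hdf' : Differentiable ℝ (deriv f) := (hf.toPeriodicCk.deriv (k := 1)).differentiable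
  have hexpand : deriv (deriv (f * w) * w) t = deriv (deriv f) t * w t ^ 2
      + 3 * deriv f t * w t * deriv w t + f t * (deriv (deriv w) t * w t + deriv w t ^ 2) := by
    have hfw : deriv (f * w) = deriv f * w + f * deriv w := funext fun x =>
      deriv_mul (hdf x) (hdw x)
    rw [hfw, deriv_mul (((hdf'.mul hdw).add (hdf.mul hdw')) t) (hdw t),
      deriv_add ((hdf'.mul hdw) t) ((hdf.mul hdw') t), deriv_mul (hdf' t) (hdw t),
      deriv_mul (hdf t) (hdw' t)]
    simp only [Pi.add_apply, Pi.mul_apply]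
    ring
  have hf0 := hf.nonneg t
  have hf1 := hf.abs_deriv_le one_le_two t
  have hf2 := hf.abs_deriv_deriv_le le_rfl t
  have hK0 := hK.nonneg
  have hw1 : |deriv w t| ≤ K := by simpa using hK 1 one_le_two t
  have hw2 : |deriv (deriv w) t| ≤ K := by simpa [iteratedDeriv_succ] using hK 2 le_rfl t
  have hθsq : w t ^ 2 ≤ θ := by nlinarith [hw0 t, hθ t]
  have hwone : w t ≤ 1 := (hθ t).trans hθ1
  rw [hexpand]
  calc _ ≤ |deriv (deriv f) t| * w t ^ 2 + 3 * |deriv f t| * w t * |deriv w t|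
        + f t * (|deriv (deriv w) t| * w t + |deriv w t| ^ 2) := by
        refine (abs_add_three _ _ _).trans ?_
        simp only [abs_mul, abs_pow, abs_of_nonneg (hw0 t), abs_of_nonneg hf0,
          abs_of_pos (three_pos (α := ℝ))]
        gcongr
        refine (abs_add_le _ _).trans_eq ?_
        rw [abs_mul, abs_pow, abs_of_nonneg (hw0 t)]
    _ ≤ a ^ 2 * f t * θ + 3 * (a * f t) * 1 * K + f t * (K * 1 + K ^ 2) := by
        have hnonneg := hw0 t
        gcongr
    _ ≤ (θ * a ^ 2 + (4 * K + K ^ 2) * a) * f t := by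
        have : (K + K ^ 2) * f t ≤ (K + K ^ 2) * f t * a :=
          le_mul_of_one_le_right (by positivity) ha
        linarith

end

/-- The opening of the cone contracted by an expanding map with `T' ≥ 1 / θ` and with the first two
derivatives of `1 / T'` bounded by `K`. -/
noncomputable def coneConst (θ K : ℝ) : ℝ := 2 * (4 * K + K ^ 2 + 1) / (1 - θ)

theorem one_sub_mul_coneConst {θ K : ℝ} (hθ : θ < 1) :
    (1 - θ) * coneConst θ K = 2 * (4 * K + K ^ 2 + 1) :=
  mul_div_cancel₀ _ (sub_pos.2 hθ).ne'

theorem one_le_coneConst {θ K : ℝ} (hθ0 : 0 ≤ θ) (hθ : θ < 1) (hK : 0 ≤ K) :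
    1 ≤ coneConst θ K := by
  rw [coneConst, le_div_iff₀ (sub_pos.2 hθ)]
  nlinarith

theorem PeriodicCk.exists_forall_le {k : ℕ} {f : ℝ → ℝ} (hf : PeriodicCk k f) :
    ∃ s, ∀ t, f t ≤ f s := by
  obtain ⟨_, ⟨s, rfl⟩, hs⟩ :=
    (hf.periodic.compact_of_continuous one_ne_zero hf.continuous).exists_isGreatest
      (range_nonempty f)
  exact ⟨s, fun t => hs (mem_range_self t)⟩

namespace ExpandingLift

variable {k d : ℕ} {θ K : ℝ} {F f g : ℝ → ℝ}

theorem abs_liftTransfer_le_mul (hF : ExpandingLift d F) {c : ℝ} (h : ∀ t, |f t| ≤ c * g t)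
    (x : ℝ) : |liftTransfer d F f x| ≤ c * liftTransfer d F g x := by
  have hle := hF.abs_liftTransfer_le (g := c • g) h x
  rwa [map_smul] at hle

theorem deriv_deriv_liftTransfer (hF : ExpandingLift d F) (hf : ContDiff ℝ 2 f) :
    deriv (deriv (liftTransfer d F f)) =
      liftTransfer d F (deriv (deriv (f * weight F) * weight F)) := by
  have hfw : ContDiff ℝ 1 (deriv (f * weight F)) :=
    ContDiff.deriv' (hf.mul hF.periodicCk_weight.contDiff)
  rw [hF.deriv_liftTransfer (hf.differentiable (by norm_num)),
    hF.deriv_liftTransfer (hfw.differentiable one_ne_zero)]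

theorem strictCone (hF : ExpandingLift d F) (hk1 : 1 ≤ k) (hk2 : k ≤ 2)
    (hθ : ∀ t, weight F t ≤ θ) (hθ1 : θ < 1) (hK : CkBound k K (weight F)) :
    StrictCone k d (coneConst θ K) ((1 + θ) / 2) F := by
  have hθ0 : 0 ≤ θ := (hF.weight_pos 0).le.trans (hθ 0)
  have hK0 := hK.nonneg
  have ha := one_le_coneConst hθ0 hθ1 hK0
  have hmul := one_sub_mul_coneConst (K := K) hθ1
  refine ⟨hF, hk1, hk2, ha, by linarith, by linarith, fun f hf j hj1 hjk t => ?_⟩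
  have hw0 (t : ℝ) : 0 ≤ weight F t := (hF.weight_pos t).le
  have hLf : 0 ≤ liftTransfer d F f t := by
    simpa using hF.liftTransfer_mono (f := 0) hf.nonneg t
  obtain rfl | rfl : j = 1 ∨ j = 2 := by omega
  · rw [iteratedDeriv_one, pow_one, hF.deriv_liftTransfer (hf.of_le hk1).differentiable]
    refine (hF.abs_liftTransfer_le_mul (hf.abs_deriv_mul_le hk1
      (hF.periodicCk_weight.of_le one_le_two).differentiable hw0 hθ
      (fun j hj => hK j (hj.trans hk1))) t).trans (mul_le_mul_of_nonneg_right ?_ hLf)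
    nlinarith
  · obtain rfl : k = 2 := le_antisymm hk2 hjk
    rw [iteratedDeriv_succ, iteratedDeriv_one, hF.deriv_deriv_liftTransfer hf.contDiff]
    refine (hF.abs_liftTransfer_le_mul (hf.abs_deriv_deriv_mul_mul_le ha
      hF.periodicCk_weight.contDiff hw0 hθ hθ1.le hK) t).trans
      (mul_le_mul_of_nonneg_right ?_ hLf)
    nlinarith

theorem exists_weight_le (hF : ExpandingLift d F) : ∃ θ < 1, ∀ t, weight F t ≤ θ := by
  obtain ⟨s, hs⟩ := hF.periodicCk_weight.exists_forall_le
  exact ⟨weight F s, hF.weight_lt_one s, hs⟩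

theorem exists_strictCone (hF : ExpandingLift d F) (hk1 : 1 ≤ k) (hk2 : k ≤ 2) :
    ∃ a κ, StrictCone k d a κ F := by
  obtain ⟨θ, hθ1, hθ⟩ := hF.exists_weight_le
  obtain ⟨K, hK⟩ := (hF.periodicCk_weight.of_le hk2).exists_ckBound
  exact ⟨_, _, hF.strictCone hk1 hk2 hθ hθ1 hK⟩

end ExpandingLift

/-! ### The invariant density -/

/-- `f` is an invariant probability density of the transfer operator on the line. -/
structure IsFixedDensity (d : ℕ) (F f : ℝ → ℝ) : Prop extends PeriodicCk 0 f where
  nonneg : ∀ t, 0 ≤ f t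
  integral_eq_one : ∫ t in (0 : ℝ)..1, f t = 1
  fixed : liftTransfer d F f = f

namespace ExpandingLift

variable {d : ℕ} {F f g : ℝ → ℝ}

theorem exists_pos_isFixedDensity (hF : ExpandingLift d F) :
    ∃ f, PeriodicCk 2 f ∧ (∀ t, 0 < f t) ∧ IsFixedDensity d F f := by
  obtain ⟨a, κ, h⟩ := hF.exists_strictCone one_le_two le_rfl
  let e : ℝ → ℝ := Function.const ℝ 1
  have he : PeriodicCk 2 e := .const 1
  have he1 : ∫ t in (0 : ℝ)..1, e t = 1 := by simp [e]
  let g : ℝ → ℝ := e - liftTransfer d F e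
  have hg : PeriodicCk 2 g := he.sub (hF.periodicCk_liftTransfer le_rfl he)
  have hg0 : ∫ t in (0 : ℝ)..1, g t = 0 :=
    hF.integral_sub_liftTransfer (he.of_le (Nat.zero_le 2))
  let f : ℝ → ℝ := e - neumannSeries d F g
  have hf : PeriodicCk 2 f := he.sub (h.periodicCk_neumannSeries hg hg0)
  have hpos (t : ℝ) : 0 < f t := (Real.exp_pos (-a)).trans_le <|
    ge_of_tendsto' (h.tendsto_liftTransfer_pow he t) fun n => by
      have hcone := h.inCone_liftTransfer_pow (InCone.const zero_le_one h.a_nonneg) n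
      have hle := hcone.exp_neg_mul_integral_le h.one_le h.a_nonneg t
      rwa [hF.integral_liftTransfer_pow (he.of_le (Nat.zero_le 2)), he1, mul_one] at hle
  refine ⟨f, hf, hpos, hf.of_le (Nat.zero_le 2), fun t => (hpos t).le, ?_, ?_⟩
  · have hsub := intervalIntegral.integral_sub (μ := volume) (he.continuous.intervalIntegrable 0 1)
      ((h.periodicCk_neumannSeries hg hg0).continuous.intervalIntegrable 0 1)
    rw [he1, h.integral_neumannSeries hg hg0, sub_zero] at hsub
    exact hsub
  · rw [← sub_eq_zero, ← neg_eq_zero, neg_sub, map_sub, sub_sub_sub_comm,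
      h.neumannSeries_sub_liftTransfer hg hg0, sub_self]

theorem lipschitzWith_invLift (hF : ExpandingLift d F) {θ : NNReal} (hθ : ∀ t, weight F t ≤ θ) :
    LipschitzWith θ (invLift F) :=
  lipschitzWith_of_nnnorm_deriv_le (fun x => (hF.hasDerivAt_invLift x).differentiableAt)
    fun x => by
      rw [(hF.hasDerivAt_invLift x).deriv, ← NNReal.coe_le_coe, coe_nnnorm, Real.norm_eq_abs,
        abs_of_pos (hF.weight_pos _)]
      exact hθ _

theorem uniformContinuous_invLift (hF : ExpandingLift d F) : UniformContinuous (invLift F) :=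
  (hF.lipschitzWith_invLift (θ := 1) fun t => (hF.weight_lt_one t).le).uniformContinuous

theorem apply_invLift_eq_zero (hF : ExpandingLift d F) (hf0 : ∀ t, 0 ≤ f t) {x : ℝ}
    (hx : liftTransfer d F f x = 0) : f (invLift F x) = 0 := by
  have hnonneg (t : ℝ) : 0 ≤ (f * weight F) t := mul_nonneg (hf0 t) (hF.weight_pos t).le
  rw [liftTransfer_eq_branchSum, branchSum_apply,
    Finset.sum_eq_zero_iff_of_nonneg fun i _ => hnonneg _] at hx
  have hbranch := hx 0 (Finset.mem_range.2 hF.degree_pos)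
  rw [Nat.cast_zero, add_zero] at hbranch
  exact (mul_eq_zero.1 hbranch).resolve_right (hF.weight_pos _).ne'

/-- Preimages of a zero are zeros, and they are dense. -/
theorem eq_zero_of_fixed (hF : ExpandingLift d F) (hf : PeriodicCk 0 f) (hf0 : ∀ t, 0 ≤ f t)
    (hL : liftTransfer d F f = f) {s : ℝ} (hs : f s = 0) : f = 0 := by
  obtain ⟨θ, hθ1, hθ⟩ := hF.exists_weight_le
  lift θ to NNReal using (hF.weight_pos 0).le.trans (hθ 0)
  have hzero (n : ℕ) {x : ℝ} (hx : f x = 0) : f ((invLift F)^[n] x) = 0 := by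
    induction n with
    | zero => exact hx
    | succ n ih =>
      rw [Function.iterate_succ_apply']
      exact hF.apply_invLift_eq_zero hf0 (by rw [hL, ih])
  ext t
  choose z hz hzs using fun n : ℕ => hf.periodic.exists_mem_Ico one_pos s (F^[n] t)
  have hdist (n : ℕ) : dist ((invLift F)^[n] (z n)) t ≤ (θ : ℝ) ^ n := by
    have hlip := ((hF.lipschitzWith_invLift hθ).iterate n).dist_le_mul (z n) (F^[n] t)
    rw [Function.LeftInverse.iterate hF.invLift_apply n t] at hlip
    refine hlip.trans ?_
    have hz1 : dist (z n) (F^[n] t) ≤ 1 := by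
      rw [Real.dist_eq, abs_le]
      constructor <;> linarith [(hz n).1, (hz n).2]
    simpa using mul_le_mul_of_nonneg_left hz1 (pow_nonneg θ.coe_nonneg n)
  have hlim : Tendsto (fun n => (invLift F)^[n] (z n)) atTop (𝓝 t) :=
    tendsto_iff_dist_tendsto_zero.2 (squeeze_zero (fun _ => dist_nonneg) hdist
      (tendsto_pow_atTop_nhds_zero_of_lt_one θ.coe_nonneg hθ1))
  have hflim := (hf.continuous.tendsto t).comp hlim
  simp only [Function.comp_def, fun n => hzero n ((hzs n).symm.trans hs)] at hflim
  exact tendsto_nhds_unique hflim tendsto_const_nhds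

theorem exists_eq_smul_of_fixed (hF : ExpandingLift d F) (hf : PeriodicCk 0 f)
    (hL : liftTransfer d F f = f) (hg : PeriodicCk 0 g) (hLg : liftTransfer d F g = g)
    (hg0 : ∀ t, 0 < g t) : ∃ m : ℝ, f = m • g := by
  have hquot : PeriodicCk 0 (f / g) :=
    ⟨hf.contDiff.div hg.contDiff fun t => (hg0 t).ne', hf.periodic.div hg.periodic⟩
  obtain ⟨s, hs⟩ := hquot.exists_forall_le
  refine ⟨f s / g s, (sub_eq_zero.1 ?_).symm⟩
  refine hF.eq_zero_of_fixed (s := s) ((hg.const_smul _).sub hf)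
    (fun t => sub_nonneg.2 ((div_le_iff₀ (hg0 t)).1 (hs t))) (by rw [map_sub, map_smul, hL, hLg])
    ?_
  simp [div_mul_cancel₀ _ (hg0 s).ne']

end ExpandingLift

theorem IsFixedDensity.eq {d : ℕ} {F f g : ℝ → ℝ} (hF : ExpandingLift d F)
    (hf : IsFixedDensity d F f) (hg : IsFixedDensity d F g) : f = g := by
  obtain ⟨p, -, hp0, hp⟩ := hF.exists_pos_isFixedDensity
  have heq {f : ℝ → ℝ} (hf : IsFixedDensity d F f) : f = p := by
    obtain ⟨m, rfl⟩ := hF.exists_eq_smul_of_fixed hf.toPeriodicCk hf.fixed hp.toPeriodicCk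
      hp.fixed hp0
    have hm : m = 1 := by simpa [hp.integral_eq_one] using hf.integral_eq_one
    rw [hm, one_smul]
  rw [heq hf, heq hg]

/-! ### Uniform first-order expansions -/

section Uniform

variable {ι α : Type*} {l : Filter ι} {u v : ι → α → ℝ} {u₀ v₀ : α → ℝ}

theorem tendstoUniformly_iff_abs_sub_lt :
    TendstoUniformly u u₀ l ↔ ∀ c > 0, ∀ᶠ i in l, ∀ x, |u i x - u₀ x| < c := by
  simp only [Metric.tendstoUniformly_iff, dist_comm (u₀ _), Real.dist_eq]

theorem tendstoUniformly_of_abs_sub_le {b : ι → ℝ} (h : ∀ᶠ i in l, ∀ x, |u i x - u₀ x| ≤ b i)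
    (hb : Tendsto b l (𝓝 0)) : TendstoUniformly u u₀ l := by
  refine tendstoUniformly_iff_abs_sub_lt.2 fun c hc => ?_
  filter_upwards [h, hb.eventually_lt_const hc] with i hi hic x using (hi x).trans_lt hic

theorem tendstoUniformly_const (w : α → ℝ) : TendstoUniformly (fun _ : ι => w) w l :=
  tendstoUniformly_of_abs_sub_le (b := fun _ => 0) (.of_forall fun _ _ => by simp)
    tendsto_const_nhds

theorem tendstoUniformly_mul (hu : TendstoUniformly u u₀ l) (hv : TendstoUniformly v v₀ l)
    (hu₀ : ∃ M, ∀ x, |u₀ x| ≤ M) (hv₀ : ∃ M, ∀ x, |v₀ x| ≤ M) :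
    TendstoUniformly (u * v) (u₀ * v₀) l := by
  obtain ⟨M, hM⟩ := hu₀
  obtain ⟨N, hN⟩ := hv₀
  have hmul : UniformContinuousOn (fun p : ℝ × ℝ => p.1 * p.2)
      (Metric.closedBall 0 (M + 1) ×ˢ Metric.closedBall 0 (N + 1)) :=
    ((isCompact_closedBall _ _).prod (isCompact_closedBall _ _)).uniformContinuousOn_of_continuous
      continuous_mul.continuousOn
  have huv : TendstoUniformly (fun i x => (u i x, v i x)) (fun x => (u₀ x, v₀ x)) l :=
    fun s hs => ((hu.prodMk hv) s hs).diag_of_prod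
  refine hmul.comp_tendstoUniformly_eventually ?_ (fun x => ?_) huv
  · filter_upwards [tendstoUniformly_iff_abs_sub_lt.1 hu 1 one_pos,
      tendstoUniformly_iff_abs_sub_lt.1 hv 1 one_pos] with i hui hvi x
    simp only [mem_prod, mem_closedBall_zero_iff, Real.norm_eq_abs]
    have hu' := abs_sub_abs_le_abs_sub (u i x) (u₀ x)
    have hv' := abs_sub_abs_le_abs_sub (v i x) (v₀ x)
    constructor <;> linarith [hui x, hvi x, hM x, hN x]
  · simp only [mem_prod, mem_closedBall_zero_iff, Real.norm_eq_abs]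
    constructor <;> linarith [hM x, hN x]

theorem tendstoUniformly_finset_sum {β : Type*} {w : β → ι → α → ℝ} {w₀ : β → α → ℝ}
    (s : Finset β) (h : ∀ b ∈ s, TendstoUniformly (w b) (w₀ b) l) :
    TendstoUniformly (∑ b ∈ s, w b) (∑ b ∈ s, w₀ b) l := by
  classical
  induction s using Finset.induction_on with
  | empty => exact tendstoUniformly_const _
  | insert b s hb ih =>
    rw [Finset.sum_insert hb, Finset.sum_insert hb]
    exact (h b (s.mem_insert_self b)).add (ih fun b' hb' => h b' (Finset.mem_insert_of_mem hb'))

theorem tendstoUniformly_comp {β γ : Type*} [UniformSpace β] [UniformSpace γ] {φ : ι → β → γ}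
    {φ₀ : β → γ} {g : ι → α → β} {g₀ : α → β} (hφ : TendstoUniformly φ φ₀ l)
    (hφ₀ : UniformContinuous φ₀) (hg : TendstoUniformly g g₀ l) :
    TendstoUniformly (fun i => φ i ∘ g i) (φ₀ ∘ g₀) l := by
  intro s hs
  obtain ⟨t, ht, hts⟩ := comp_mem_uniformity_sets hs
  filter_upwards [hφ t ht, (hφ₀.comp_tendstoUniformly hg) t ht] with i hφi hgi x
  exact hts ⟨φ₀ (g i x), hgi x, hφi (g i x)⟩

end Uniform

theorem exists_mem_uIcc_sub_eq_deriv_mul {Ψ : ℝ → ℝ} (hΨ : Differentiable ℝ Ψ) (x y : ℝ) :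
    ∃ ξ ∈ uIcc x y, Ψ y - Ψ x = deriv Ψ ξ * (y - x) := by
  rcases eq_or_ne x y with rfl | hxy
  · exact ⟨x, left_mem_uIcc, by simp⟩
  wlog h : x < y generalizing x y
  · obtain ⟨ξ, hξ, hslope⟩ := this y x hxy.symm (hxy.lt_or_gt.resolve_left h)
    exact ⟨ξ, uIcc_comm x y ▸ hξ, by linarith⟩
  obtain ⟨ξ, hξ, hslope⟩ :=
    exists_deriv_eq_slope Ψ h hΨ.continuous.continuousOn hΨ.differentiableOn
  exact ⟨ξ, Icc_subset_uIcc (Ioo_subset_Icc_self hξ), by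
    rw [hslope, div_mul_cancel₀ _ (sub_pos.2 h).ne']⟩

section Slope

variable {u : ℝ → ℝ → ℝ} {u₀ : ℝ → ℝ}

theorem tendstoUniformly_smul_zero (hu : TendstoUniformly u u₀ (𝓝[>] 0))
    (hu₀ : ∃ M, ∀ x, |u₀ x| ≤ M) : TendstoUniformly (fun δ => δ • u δ) 0 (𝓝[>] 0) := by
  have hδ : TendstoUniformly (fun (δ : ℝ) (_ : ℝ) => δ) 0 (𝓝[>] 0) :=
    tendstoUniformly_of_abs_sub_le (b := abs) (.of_forall fun δ x => by simp)
      (tendsto_nhdsWithin_of_tendsto_nhds (by simpa using continuous_abs.tendsto (0 : ℝ)))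
  have := tendstoUniformly_mul hδ hu ⟨0, by simp⟩ hu₀
  rwa [zero_mul] at this

theorem tendstoUniformly_slope_comp {Ψ : ℝ → ℝ} (hΨ : Differentiable ℝ Ψ)
    (hΨ' : UniformContinuous (deriv Ψ)) (hbdd : ∃ M, ∀ x, |deriv Ψ x| ≤ M)
    (hu : TendstoUniformly u u₀ (𝓝[>] 0)) (hu₀ : ∃ M, ∀ x, |u₀ x| ≤ M) :
    TendstoUniformly (fun δ => δ⁻¹ • (Ψ ∘ (id + δ • u δ) - Ψ)) (deriv Ψ * u₀) (𝓝[>] 0) := by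
  choose ξ hξ hslope using fun δ x => exists_mem_uIcc_sub_eq_deriv_mul hΨ x (x + δ * u δ x)
  have hξ_tendsto : TendstoUniformly ξ id (𝓝[>] 0) := by
    have hsmall := tendstoUniformly_smul_zero hu hu₀
    rw [tendstoUniformly_iff_abs_sub_lt] at hsmall ⊢
    intro c hc
    filter_upwards [hsmall c hc] with δ hδ x
    have hle := abs_sub_left_of_mem_uIcc (hξ δ x)
    rw [add_sub_cancel_left] at hle
    exact hle.trans_lt (by simpa using hδ x)
  refine (tendstoUniformly_congr ?_).1
    (tendstoUniformly_mul (hΨ'.comp_tendstoUniformly hξ_tendsto) hu hbdd hu₀)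
  filter_upwards [self_mem_nhdsWithin] with δ (hδ : 0 < δ)
  funext x
  simp only [Pi.mul_apply, Pi.smul_apply, Pi.sub_apply, Pi.add_apply, Function.comp_apply, id_eq,
    smul_eq_mul, hslope, add_sub_cancel_left]
  field_simp

end Slope

/-- The expansion `u_δ = u₀ + δ v + o(δ)` in the space of continuous `1`-periodic functions, as
`δ → 0⁺`. -/
structure HasExpansion (u : ℝ → ℝ → ℝ) (u₀ v : ℝ → ℝ) : Prop where
  periodicCk : PeriodicCk 0 u₀
  periodicCk_slope : PeriodicCk 0 v
  tendstoUniformly_slope : TendstoUniformly (fun δ => δ⁻¹ • (u δ - u₀)) v (𝓝[>] 0)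

namespace HasExpansion

variable {u w : ℝ → ℝ → ℝ} {u₀ v w₀ z : ℝ → ℝ}

theorem tendstoUniformly (hu : HasExpansion u u₀ v) : TendstoUniformly u u₀ (𝓝[>] 0) := by
  have hsmall := (tendstoUniformly_smul_zero hu.tendstoUniformly_slope
    hu.periodicCk_slope.exists_abs_le).add (tendstoUniformly_const u₀)
  rw [zero_add] at hsmall
  refine (tendstoUniformly_congr ?_).1 hsmall
  filter_upwards [self_mem_nhdsWithin] with δ (hδ : 0 < δ)
  rw [Pi.add_apply, smul_inv_smul₀ hδ.ne', sub_add_cancel]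

theorem congr (hu : HasExpansion u u₀ v) (h : u =ᶠ[𝓝[>] 0] w) : HasExpansion w u₀ v :=
  ⟨hu.periodicCk, hu.periodicCk_slope,
    (tendstoUniformly_congr (h.mono fun δ hδ => by simp only [hδ])).1 hu.tendstoUniformly_slope⟩

theorem const (hu₀ : PeriodicCk 0 u₀) : HasExpansion (fun _ => u₀) u₀ 0 :=
  ⟨hu₀, .const 0, by
    simpa only [sub_self, smul_zero] using tendstoUniformly_const (0 : ℝ → ℝ)⟩

theorem neg (hu : HasExpansion u u₀ v) : HasExpansion (-u) (-u₀) (-v) :=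
  ⟨hu.periodicCk.neg, hu.periodicCk_slope.neg, by
    convert hu.tendstoUniformly_slope.neg using 2 with δ
    simp only [Pi.neg_apply, ← smul_neg]
    congr 1; abel⟩

theorem add (hu : HasExpansion u u₀ v) (hw : HasExpansion w w₀ z) :
    HasExpansion (u + w) (u₀ + w₀) (v + z) :=
  ⟨hu.periodicCk.add hw.periodicCk, hu.periodicCk_slope.add hw.periodicCk_slope, by
    convert hu.tendstoUniformly_slope.add hw.tendstoUniformly_slope using 2 with δ
    simp only [Pi.add_apply, ← smul_add]
    congr 1; abel⟩

theorem mul (hu : HasExpansion u u₀ v) (hw : HasExpansion w w₀ z) :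
    HasExpansion (u * w) (u₀ * w₀) (v * w₀ + u₀ * z) := by
  refine ⟨hu.periodicCk.mul hw.periodicCk, (hu.periodicCk_slope.mul hw.periodicCk).add
    (hu.periodicCk.mul hw.periodicCk_slope), ?_⟩
  have hvw := tendstoUniformly_mul hu.tendstoUniformly_slope hw.tendstoUniformly
    hu.periodicCk_slope.exists_abs_le hw.periodicCk.exists_abs_le
  have huz := tendstoUniformly_mul (tendstoUniformly_const u₀) hw.tendstoUniformly_slope
    hu.periodicCk.exists_abs_le hw.periodicCk_slope.exists_abs_le
  convert hvw.add huz using 2 with δ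
  funext t
  simp only [Pi.mul_apply, Pi.add_apply, Pi.sub_apply, Pi.smul_apply, smul_eq_mul]
  ring

end HasExpansion

section TendstoCk

variable {ι : Type*} {l : Filter ι} {k : ℕ} {u : ι → ℝ → ℝ} {u₀ : ℝ → ℝ}

theorem TendstoCk.tendstoUniformly (h : TendstoCk k u l u₀) : TendstoUniformly u u₀ l := by
  refine tendstoUniformly_iff_abs_sub_lt.2 fun c hc => ?_
  filter_upwards [h (c / 2) (half_pos hc)] with i hi x
  exact (hi.abs_le x).trans_lt (half_lt_self hc)

theorem TendstoCk.deriv_slope {u : ℝ → ℝ → ℝ} {l : Filter ℝ} {u₀ v : ℝ → ℝ}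
    (h : TendstoCk (k + 1) (fun δ => δ⁻¹ • (u δ - u₀)) l v)
    (hu : ∀ᶠ δ in l, Differentiable ℝ (u δ)) (hu₀ : Differentiable ℝ u₀)
    (hv : Differentiable ℝ v) :
    TendstoCk k (fun δ => δ⁻¹ • (deriv (u δ) - deriv u₀)) l (deriv v) := by
  intro c hc
  filter_upwards [h c hc, hu] with δ hδ huδ j hj t
  have hderiv : deriv (δ⁻¹ • (u δ - u₀) - v) = δ⁻¹ • (deriv (u δ) - deriv u₀) - deriv v := by
    funext t
    rw [deriv_sub (((huδ t).sub (hu₀ t)).const_smul _) (hv t),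
      deriv_const_smul _ ((huδ t).sub (hu₀ t)), deriv_sub (huδ t) (hu₀ t)]
    rfl
  rw [← hderiv, ← iteratedDeriv_succ']
  exact hδ (j + 1) (by omega) t

theorem tendstoCk_one (h : TendstoUniformly u u₀ l)
    (h' : TendstoUniformly (fun i => deriv (u i)) (deriv u₀) l)
    (hu : ∀ᶠ i in l, Differentiable ℝ (u i)) (hu₀ : Differentiable ℝ u₀) : TendstoCk 1 u l u₀ := by
  intro c hc
  filter_upwards [tendstoUniformly_iff_abs_sub_lt.1 h c hc,
    tendstoUniformly_iff_abs_sub_lt.1 h' c hc, hu] with i hi hi' hui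
  refine ckBound_one_iff.2 ⟨fun t => (hi t).le, fun t => ?_⟩
  rw [deriv_sub (hui t) (hu₀ t)]
  exact (hi' t).le

end TendstoCk

/-- A family of expanding lifts with `F_δ = F₀ + δ e + o(δ)` in `C^2`, as `δ → 0⁺`. -/
structure LiftFamily (d : ℕ) (F : ℝ → ℝ → ℝ) (F₀ e : ℝ → ℝ) : Prop where
  base : ExpandingLift d F₀
  lift : ∀ᶠ δ in 𝓝[>] 0, ExpandingLift d (F δ)
  periodicCk : PeriodicCk 2 e
  slope : TendstoCk 2 (fun δ => δ⁻¹ • (F δ - F₀)) (𝓝[>] 0) e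

/-- The derivative at `δ = 0` of `δ ↦ L_δ f` for a family of lifts `F_δ = F₀ + δ e + o(δ)`: moving
mass along the vector field `e` gives `-(L₀ (e f))'`. -/
noncomputable def liftDerivOp (d : ℕ) (F₀ e f : ℝ → ℝ) : ℝ → ℝ :=
  -deriv (liftTransfer d F₀ (e * f))

theorem ExpandingLift.periodicCk_liftDerivOp {k d : ℕ} {F₀ e f : ℝ → ℝ} (hF : ExpandingLift d F₀)
    (hk : k ≤ 1) (he : PeriodicCk (k + 1) e) (hf : PeriodicCk (k + 1) f) :
    PeriodicCk k (liftDerivOp d F₀ e f) :=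
  (hF.periodicCk_liftTransfer (Nat.succ_le_succ hk) (he.mul hf)).deriv.neg

theorem ExpandingLift.integral_liftDerivOp {d : ℕ} {F₀ e f : ℝ → ℝ} (hF : ExpandingLift d F₀)
    (he : PeriodicCk 1 e) (hf : PeriodicCk 1 f) :
    ∫ t in (0 : ℝ)..1, liftDerivOp d F₀ e f t = 0 := by
  simp only [liftDerivOp, Pi.neg_apply, intervalIntegral.integral_neg,
    (hF.periodicCk_liftTransfer one_le_two (he.mul hf)).integral_deriv, neg_zero]

namespace LiftFamily

variable {d : ℕ} {F u : ℝ → ℝ → ℝ} {F₀ e u₀ v f : ℝ → ℝ}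

theorem tendstoCk_deriv_slope (h : LiftFamily d F F₀ e) :
    TendstoCk 1 (fun δ => δ⁻¹ • (deriv (F δ) - deriv F₀)) (𝓝[>] 0) (deriv e) :=
  h.slope.deriv_slope (h.lift.mono fun _ hδ => hδ.differentiable) h.base.differentiable
    h.periodicCk.differentiable

theorem hasExpansion_deriv (h : LiftFamily d F F₀ e) :
    HasExpansion (fun δ => deriv (F δ)) (deriv F₀) (deriv e) :=
  ⟨h.base.periodicCk_deriv.of_le zero_le_two, h.periodicCk.deriv.of_le zero_le_one,
    h.tendstoCk_deriv_slope.tendstoUniformly⟩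

theorem hasExpansion_deriv_deriv (h : LiftFamily d F F₀ e) :
    HasExpansion (fun δ => deriv (deriv (F δ))) (deriv (deriv F₀)) (deriv (deriv e)) :=
  ⟨h.base.periodicCk_deriv.deriv.of_le zero_le_one, h.periodicCk.deriv.deriv,
    (h.tendstoCk_deriv_slope.deriv_slope
      (h.lift.mono fun _ hδ => hδ.periodicCk_deriv.differentiable)
      h.base.periodicCk_deriv.differentiable
      h.periodicCk.deriv.differentiable).tendstoUniformly⟩

theorem hasExpansion_weight (h : LiftFamily d F F₀ e) :
    HasExpansion (fun δ => weight (F δ)) (weight F₀) (-(deriv e * weight F₀ ^ 2)) := by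
  have hF := h.hasExpansion_deriv
  have hw₀ : PeriodicCk 0 (weight F₀) := h.base.periodicCk_weight.of_le zero_le_two
  have hsub {G : ℝ → ℝ} (hG : ExpandingLift d G) (t : ℝ) :
      weight G t - weight F₀ t = -(deriv G t - deriv F₀ t) * weight G t * weight F₀ t := by
    simp only [weight, Pi.inv_apply]
    field_simp [(hG.deriv_pos t).ne', (h.base.deriv_pos t).ne']
    ring
  have hw : TendstoUniformly (fun δ => weight (F δ)) (weight F₀) (𝓝[>] 0) := by
    refine tendstoUniformly_iff_abs_sub_lt.2 fun c hc => ?_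
    filter_upwards [tendstoUniformly_iff_abs_sub_lt.1 hF.tendstoUniformly c hc, h.lift]
      with δ hδ hFδ t
    have hle : weight (F δ) t * weight F₀ t ≤ 1 :=
      mul_le_one₀ (hFδ.weight_lt_one t).le (h.base.weight_pos t).le (h.base.weight_lt_one t).le
    rw [hsub hFδ, mul_assoc, abs_mul, abs_neg,
      abs_of_pos (mul_pos (hFδ.weight_pos t) (h.base.weight_pos t))]
    exact (mul_le_of_le_one_right (abs_nonneg _) hle).trans_lt (hδ t)
  refine ⟨hw₀, ?_, ?_⟩
  · simpa only [sq] using (hF.periodicCk_slope.mul (hw₀.mul hw₀)).neg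
  have hprod := (tendstoUniformly_mul hF.tendstoUniformly_slope
    (tendstoUniformly_mul hw (tendstoUniformly_const _) hw₀.exists_abs_le hw₀.exists_abs_le)
    hF.periodicCk_slope.exists_abs_le (hw₀.mul hw₀).exists_abs_le).neg
  rw [sq]
  refine (tendstoUniformly_congr ?_).1 hprod
  filter_upwards [h.lift] with δ hδ
  funext t
  simp only [Pi.neg_apply, Pi.mul_apply, Pi.smul_apply, Pi.sub_apply, smul_eq_mul, hsub hδ]
  ring

theorem hasExpansion_deriv_weight (h : LiftFamily d F F₀ e) :
    HasExpansion (fun δ => deriv (weight (F δ))) (deriv (weight F₀))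
      (deriv (-(deriv e * weight F₀ ^ 2))) := by
  have hw := h.hasExpansion_weight
  have hprod := (h.hasExpansion_deriv_deriv.mul (hw.mul hw)).neg
  have hslope : deriv (-(deriv e * weight F₀ ^ 2)) = -(deriv (deriv e) * (weight F₀ * weight F₀)
      + deriv (deriv F₀) * (-(deriv e * weight F₀ ^ 2) * weight F₀
        + weight F₀ * -(deriv e * weight F₀ ^ 2))) := by
    funext t
    have hwt := (h.base.periodicCk_weight.differentiable t).hasDerivAt
    rw [((h.periodicCk.deriv.differentiable t).hasDerivAt.mul (hwt.pow 2)).neg.deriv,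
      h.base.deriv_weight]
    simp only [Pi.neg_apply, Pi.mul_apply, Pi.add_apply, Pi.pow_apply]
    ring
  rw [sq] at hprod
  rw [hslope, h.base.deriv_weight, sq]
  refine hprod.congr ?_
  filter_upwards [h.lift] with δ hδ
  rw [hδ.deriv_weight, sq]
  rfl

theorem invLift_eq (h : LiftFamily d F F₀ e) {δ : ℝ} (hδ : δ ≠ 0) (hF : ExpandingLift d (F δ)) :
    invLift (F δ) = invLift F₀ ∘ (id + δ • -((δ⁻¹ • (F δ - F₀)) ∘ invLift (F δ))) := by
  funext x
  have hx : x - (F δ (invLift (F δ) x) - F₀ (invLift (F δ) x)) = F₀ (invLift (F δ) x) := by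
    rw [hF.apply_invLift, sub_sub_cancel]
  simp only [Function.comp_apply, Pi.add_apply, id_eq, Pi.smul_apply, Pi.neg_apply, Pi.sub_apply,
    smul_eq_mul, mul_neg, mul_inv_cancel_left₀ hδ, ← sub_eq_add_neg, hx, h.base.invLift_apply]

theorem tendstoUniformly_invLift (h : LiftFamily d F F₀ e) :
    TendstoUniformly (fun δ => invLift (F δ)) (invLift F₀) (𝓝[>] 0) := by
  have hdist : TendstoUniformly (fun δ => F₀ ∘ invLift (F δ)) id (𝓝[>] 0) := by
    have hsmall := tendstoUniformly_smul_zero h.slope.tendstoUniformly h.periodicCk.exists_abs_le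
    rw [tendstoUniformly_iff_abs_sub_lt] at hsmall ⊢
    intro c hc
    filter_upwards [hsmall c hc, h.lift, self_mem_nhdsWithin] with δ hδ hFδ (hδ0 : 0 < δ) x
    have hx := hδ (invLift (F δ) x)
    rwa [smul_inv_smul₀ hδ0.ne', Pi.sub_apply, hFδ.apply_invLift, Pi.zero_apply, sub_zero,
      abs_sub_comm] at hx
  refine (tendstoUniformly_congr (.of_forall fun δ => ?_)).1
    (h.base.uniformContinuous_invLift.comp_tendstoUniformly hdist)
  exact funext fun x => h.base.invLift_apply _

theorem tendstoUniformly_slope_comp_invLift (h : LiftFamily d F F₀ e) (hu : HasExpansion u u₀ v)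
    (hu₀ : PeriodicCk 1 u₀) :
    TendstoUniformly (fun δ => δ⁻¹ • (u δ ∘ invLift (F δ) - u₀ ∘ invLift F₀))
      ((v - deriv u₀ * weight F₀ * e) ∘ invLift F₀) (𝓝[>] 0) := by
  have hG := h.tendstoUniformly_invLift
  have hG₀ := h.base.uniformContinuous_invLift
  have he := h.periodicCk.exists_abs_le
  have hu₀w : PeriodicCk 0 (deriv u₀ * weight F₀) :=
    hu₀.deriv.mul (h.base.periodicCk_weight.of_le zero_le_two)
  have hΨ (x : ℝ) : HasDerivAt (u₀ ∘ invLift F₀) ((deriv u₀ * weight F₀) (invLift F₀ x)) x :=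
    (hu₀.differentiable _).hasDerivAt.comp x (h.base.hasDerivAt_invLift x)
  have hΨ' : deriv (u₀ ∘ invLift F₀) = (deriv u₀ * weight F₀) ∘ invLift F₀ :=
    funext fun x => (hΨ x).deriv
  have hmove := tendstoUniformly_slope_comp (fun x => (hΨ x).differentiableAt)
    (hΨ' ▸ hu₀w.uniformContinuous.comp hG₀)
    (hΨ' ▸ hu₀w.exists_abs_le.imp fun M hM x => hM _)
    (tendstoUniformly_comp h.slope.tendstoUniformly h.periodicCk.uniformContinuous hG).neg
    (he.imp fun M hM x => (abs_neg _).trans_le (hM (invLift F₀ x)))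
  have hvalue := tendstoUniformly_comp hu.tendstoUniformly_slope
    hu.periodicCk_slope.uniformContinuous hG
  have hlim : (v - deriv u₀ * weight F₀ * e) ∘ invLift F₀
      = v ∘ invLift F₀ + deriv (u₀ ∘ invLift F₀) * -(e ∘ invLift F₀) := by
    rw [hΨ', mul_neg, ← sub_eq_add_neg]
    rfl
  rw [hlim]
  refine (tendstoUniformly_congr ?_).1 (hvalue.add hmove)
  filter_upwards [h.lift, self_mem_nhdsWithin] with δ hδ (hδ0 : 0 < δ)
  rw [Pi.add_apply, Pi.neg_apply, Function.comp_assoc, ← h.invLift_eq hδ0.ne' hδ]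
  funext x
  simp only [Pi.add_apply, Pi.smul_apply, Pi.sub_apply, Function.comp_apply, smul_eq_mul]
  ring

theorem hasExpansion_branchSum (h : LiftFamily d F F₀ e) (hu : HasExpansion u u₀ v)
    (hu₀ : PeriodicCk 1 u₀) :
    HasExpansion (fun δ => branchSum d (F δ) (u δ)) (branchSum d F₀ u₀)
      (branchSum d F₀ (v - deriv u₀ * weight F₀ * e)) := by
  refine ⟨h.base.periodicCk_branchSum (by norm_num) hu.periodicCk,
    h.base.periodicCk_branchSum (by norm_num) (hu.periodicCk_slope.sub
      ((hu₀.deriv.mul (h.base.periodicCk_weight.of_le zero_le_two)).mul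
        (h.periodicCk.of_le zero_le_two))), ?_⟩
  have hsum := tendstoUniformly_finset_sum (Finset.range d) fun i _ =>
    (h.tendstoUniformly_slope_comp_invLift hu hu₀).comp fun x : ℝ => x + i
  convert hsum using 1
  · funext δ x
    simp only [Pi.smul_apply, Pi.sub_apply, branchSum_apply, ← Finset.sum_sub_distrib,
      Finset.smul_sum, Finset.sum_apply, Function.comp_apply]
  · funext x
    simp only [branchSum_apply, Finset.sum_apply, Function.comp_apply]

theorem tendstoUniformly_branchSum (h : LiftFamily d F F₀ e)
    (hu : TendstoUniformly u u₀ (𝓝[>] 0)) (hu₀ : UniformContinuous u₀) :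
    TendstoUniformly (fun δ => branchSum d (F δ) (u δ)) (branchSum d F₀ u₀) (𝓝[>] 0) := by
  have hsum := tendstoUniformly_finset_sum (Finset.range d) fun i _ =>
    (tendstoUniformly_comp hu hu₀ h.tendstoUniformly_invLift).comp fun x : ℝ => x + i
  convert hsum using 1
  · funext δ x
    simp only [branchSum_apply, Finset.sum_apply, Function.comp_apply]
  · funext x
    simp only [branchSum_apply, Finset.sum_apply, Function.comp_apply]

theorem hasExpansion_liftTransfer (h : LiftFamily d F F₀ e) (hu : HasExpansion u u₀ v)
    (hu₀ : PeriodicCk 1 u₀) :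
    HasExpansion (fun δ => liftTransfer d (F δ) (u δ)) (liftTransfer d F₀ u₀)
      (liftTransfer d F₀ v + liftDerivOp d F₀ e u₀) := by
  have hw : PeriodicCk 1 (weight F₀) := h.base.periodicCk_weight.of_le one_le_two
  have he : PeriodicCk 1 e := h.periodicCk.of_le one_le_two
  have hexp := h.hasExpansion_branchSum (hu.mul h.hasExpansion_weight) (hu₀.mul hw)
  have hslope : v * weight F₀ + u₀ * -(deriv e * weight F₀ ^ 2)
      - deriv (u₀ * weight F₀) * weight F₀ * e
      = v * weight F₀ - deriv (e * u₀ * weight F₀) * weight F₀ := by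
    funext t
    have hut := (hu₀.differentiable t).hasDerivAt
    have hwt := (hw.differentiable t).hasDerivAt
    have het := (he.differentiable t).hasDerivAt
    simp only [Pi.add_apply, Pi.sub_apply, Pi.mul_apply, Pi.neg_apply, Pi.pow_apply,
      (hut.mul hwt).deriv, ((het.mul hut).mul hwt).deriv]
    ring
  rw [hslope, map_sub] at hexp
  rw [liftDerivOp, h.base.deriv_liftTransfer (he.mul hu₀).differentiable, ← sub_eq_add_neg]
  exact hexp

theorem tendstoUniformly_liftTransfer (h : LiftFamily d F F₀ e)
    (hu : TendstoUniformly u u₀ (𝓝[>] 0)) (hu₀ : PeriodicCk 0 u₀) :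
    TendstoUniformly (fun δ => liftTransfer d (F δ) (u δ)) (liftTransfer d F₀ u₀) (𝓝[>] 0) := by
  have hw := h.hasExpansion_weight
  exact h.tendstoUniformly_branchSum
    (tendstoUniformly_mul hu hw.tendstoUniformly hu₀.exists_abs_le hw.periodicCk.exists_abs_le)
    (hu₀.mul hw.periodicCk).uniformContinuous

theorem hasExpansion_liftTransfer_const (h : LiftFamily d F F₀ e) (hf : PeriodicCk 1 f) :
    HasExpansion (fun δ => liftTransfer d (F δ) f) (liftTransfer d F₀ f)
      (liftDerivOp d F₀ e f) := by
  simpa only [map_zero, zero_add] using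
    h.hasExpansion_liftTransfer (.const (hf.of_le zero_le_one)) hf

theorem hasExpansion_deriv_mul_weight (h : LiftFamily d F F₀ e) (hf : PeriodicCk 1 f) :
    HasExpansion (fun δ => deriv (f * weight (F δ))) (deriv (f * weight F₀))
      (deriv (f * -(deriv e * weight F₀ ^ 2))) := by
  have hexp := ((HasExpansion.const hf.deriv).mul h.hasExpansion_weight).add
    ((HasExpansion.const (hf.of_le zero_le_one)).mul h.hasExpansion_deriv_weight)
  have hderiv {g : ℝ → ℝ} (hg : Differentiable ℝ g) :
      deriv (f * g) = deriv f * g + f * deriv g :=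
    funext fun t => deriv_mul (hf.differentiable t) (hg t)
  have hw' : Differentiable ℝ (-(deriv e * weight F₀ ^ 2)) :=
    (h.periodicCk.deriv.differentiable.mul (h.base.periodicCk_weight.differentiable.pow 2)).neg
  rw [hderiv h.base.periodicCk_weight.differentiable, hderiv hw']
  simp only [zero_mul, zero_add] at hexp
  refine hexp.congr ?_
  filter_upwards [h.lift] with δ hδ
  exact (hderiv hδ.periodicCk_weight.differentiable).symm

theorem tendstoCk_liftTransfer (h : LiftFamily d F F₀ e) (hf : PeriodicCk 1 f) :
    TendstoCk 1 (fun δ => liftTransfer d (F δ) f) (𝓝[>] 0) (liftTransfer d F₀ f) := by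
  refine tendstoCk_one (h.hasExpansion_liftTransfer_const hf).tendstoUniformly ?_
    (h.lift.mono fun δ hδ => (hδ.periodicCk_liftTransfer one_le_two hf).differentiable)
    (h.base.periodicCk_liftTransfer one_le_two hf).differentiable
  have hexp := h.hasExpansion_deriv_mul_weight hf
  rw [h.base.deriv_liftTransfer hf.differentiable]
  refine (tendstoUniformly_congr ?_).1
    (h.tendstoUniformly_liftTransfer hexp.tendstoUniformly hexp.periodicCk)
  filter_upwards [h.lift] with δ hδ using (hδ.deriv_liftTransfer hf.differentiable).symm

theorem deriv_liftDerivOp (h : LiftFamily d F F₀ e) (hf : PeriodicCk 2 f) :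
    deriv (liftDerivOp d F₀ e f) =
      liftTransfer d F₀ (deriv (f * -(deriv e * weight F₀ ^ 2)))
        + liftDerivOp d F₀ e (deriv (f * weight F₀)) := by
  have hw := h.base.periodicCk_weight
  have he := h.periodicCk
  have hfw := hf.mul hw
  have he'w : PeriodicCk 1 (deriv e * (f * weight F₀)) :=
    he.deriv.mul (hfw.of_le one_le_two)
  have hefw' : PeriodicCk 1 (e * deriv (f * weight F₀)) := (he.of_le one_le_two).mul hfw.deriv
  have hdiff {g : ℝ → ℝ} (hg : PeriodicCk 1 g) : Differentiable ℝ (liftTransfer d F₀ g) :=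
    (h.base.periodicCk_liftTransfer one_le_two hg).differentiable
  have hderiv : deriv (liftTransfer d F₀ (e * f)) = liftTransfer d F₀ (deriv e * (f * weight F₀))
      + liftTransfer d F₀ (e * deriv (f * weight F₀)) := by
    rw [h.base.deriv_liftTransfer (he.mul hf).differentiable, ← map_add, mul_assoc]
    exact congrArg _ (funext fun t => deriv_mul (he.differentiable t) (hfw.differentiable t))
  have hneg : f * -(deriv e * weight F₀ ^ 2) = -(deriv e * (f * weight F₀) * weight F₀) := by ring
  have hderiv_neg (g : ℝ → ℝ) : deriv (-g) = -deriv g := funext fun t => deriv.neg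
  rw [liftDerivOp, hderiv, liftDerivOp, hneg, hderiv_neg, hderiv_neg, map_neg,
    ← h.base.deriv_liftTransfer he'w.differentiable, ← neg_add]
  exact congrArg _ (funext fun t => deriv_add (hdiff he'w t) (hdiff hefw' t))

theorem tendstoCk_slope_liftTransfer (h : LiftFamily d F F₀ e) (hf : PeriodicCk 2 f) :
    TendstoCk 1 (fun δ => δ⁻¹ • (liftTransfer d (F δ) f - liftTransfer d F₀ f)) (𝓝[>] 0)
      (liftDerivOp d F₀ e f) := by
  have hf₁ : PeriodicCk 1 f := hf.of_le one_le_two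
  have hL {G : ℝ → ℝ} (hG : ExpandingLift d G) : Differentiable ℝ (liftTransfer d G f) :=
    (hG.periodicCk_liftTransfer one_le_two hf₁).differentiable
  refine tendstoCk_one (h.hasExpansion_liftTransfer_const hf₁).tendstoUniformly_slope ?_
    (h.lift.mono fun δ hδ => ((hL hδ).sub (hL h.base)).const_smul _)
    (h.base.periodicCk_liftDerivOp le_rfl h.periodicCk hf).differentiable
  have hexp := h.hasExpansion_liftTransfer (h.hasExpansion_deriv_mul_weight hf₁)
    (hf.mul h.base.periodicCk_weight).deriv
  rw [h.deriv_liftDerivOp hf]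
  refine (tendstoUniformly_congr ?_).1 hexp.tendstoUniformly_slope
  filter_upwards [h.lift] with δ hδ
  funext t
  rw [deriv_const_smul _ ((hL hδ t).sub (hL h.base t)), deriv_sub (hL hδ t) (hL h.base t),
    hδ.deriv_liftTransfer hf.differentiable, h.base.deriv_liftTransfer hf.differentiable]
  rfl

end LiftFamily

/-! ### Linear response -/

theorem smul_sub_sub_liftTransfer {d : ℕ} {F F₀ f f₀ : ℝ → ℝ} (hf : liftTransfer d F f = f)
    (hf₀ : liftTransfer d F₀ f₀ = f₀) (c : ℝ) :
    c • (f - f₀) - liftTransfer d F (c • (f - f₀))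
      = c • (liftTransfer d F f₀ - liftTransfer d F₀ f₀) := by
  rw [map_smul, map_sub, hf, hf₀, ← smul_sub, sub_sub_sub_cancel_left]

theorem IsFixedDensity.integral_smul_sub {d : ℕ} {F F₀ f f₀ : ℝ → ℝ} (hf : IsFixedDensity d F f)
    (hf₀ : IsFixedDensity d F₀ f₀) (c : ℝ) : ∫ t in (0 : ℝ)..1, (c • (f - f₀)) t = 0 := by
  have hi {g : ℝ → ℝ} (hg : PeriodicCk 0 g) : IntervalIntegrable g volume 0 1 :=
    hg.continuous.intervalIntegrable 0 1
  simp only [Pi.smul_apply, Pi.sub_apply, intervalIntegral.integral_smul,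
    intervalIntegral.integral_sub (hi hf.toPeriodicCk) (hi hf₀.toPeriodicCk), hf.integral_eq_one,
    hf₀.integral_eq_one, sub_self, smul_zero]

namespace LiftFamily

variable {d : ℕ} {F : ℝ → ℝ → ℝ} {F₀ e : ℝ → ℝ}

theorem exists_eventually_strictCone (h : LiftFamily d F F₀ e) :
    ∃ a κ, ∀ᶠ δ in 𝓝[>] 0, StrictCone 1 d a κ (F δ) := by
  obtain ⟨θ, hθ1, hθ⟩ := h.base.exists_weight_le
  obtain ⟨K, hK⟩ := (h.base.periodicCk_weight.of_le one_le_two).exists_ckBound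
  obtain ⟨hK0, hK1⟩ := ckBound_one_iff.1 hK
  refine ⟨coneConst ((1 + θ) / 2) (K + 1), (1 + (1 + θ) / 2) / 2, ?_⟩
  filter_upwards [h.lift, tendstoUniformly_iff_abs_sub_lt.1 h.hasExpansion_weight.tendstoUniformly
    (min 1 ((1 - θ) / 2)) (lt_min one_pos (by linarith)),
    tendstoUniformly_iff_abs_sub_lt.1 h.hasExpansion_deriv_weight.tendstoUniformly 1 one_pos]
    with δ hδ hw hw'
  refine hδ.strictCone le_rfl one_le_two (fun t => ?_) (by linarith)
    (ckBound_one_iff.2 ⟨fun t => ?_, fun t => ?_⟩)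
  · linarith [hθ t, (abs_lt.1 ((hw t).trans_le (min_le_right _ _))).2]
  · linarith [hK0 t, hw t, min_le_left 1 ((1 - θ) / 2),
      abs_sub_abs_le_abs_sub (weight (F δ) t) (weight F₀ t)]
  · linarith [hK1 t, hw' t, abs_sub_abs_le_abs_sub (deriv (weight (F δ)) t) (deriv (weight F₀) t)]

theorem tendstoCk_slope_isFixedDensity (h : LiftFamily d F F₀ e) {f : ℝ → ℝ → ℝ} {f₀ v : ℝ → ℝ}
    (hf₀ : PeriodicCk 2 f₀) (hf₀' : IsFixedDensity d F₀ f₀)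
    (hf : ∀ᶠ δ in 𝓝[>] 0, PeriodicCk 1 (f δ) ∧ IsFixedDensity d (F δ) (f δ))
    (hv : PeriodicCk 1 v) (hv0 : ∫ t in (0 : ℝ)..1, v t = 0)
    (hvg : v - liftTransfer d F₀ v = liftDerivOp d F₀ e f₀) :
    TendstoCk 1 (fun δ => δ⁻¹ • (f δ - f₀)) (𝓝[>] 0) v := by
  obtain ⟨a, κ, hcone⟩ := h.exists_eventually_strictCone
  have hf₀1 := hf₀.of_le one_le_two
  have hL {G g : ℝ → ℝ} (hG : ExpandingLift d G) (hg : PeriodicCk 1 g) :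
      PeriodicCk 1 (liftTransfer d G g) := hG.periodicCk_liftTransfer one_le_two hg
  suffices hw : TendstoCk 1 (fun δ => δ⁻¹ • (f δ - f₀) - v) (𝓝[>] 0) 0 by
    simpa only [TendstoCk, sub_zero] using hw
  refine tendstoCk_zero_of_sub_liftTransfer hcone ?_ fun c hc => ?_
  · filter_upwards [hf] with δ ⟨hfδ, hfδ'⟩
    have hq : PeriodicCk 1 (δ⁻¹ • (f δ - f₀)) := (hfδ.sub hf₀1).const_smul _
    refine ⟨hq.sub hv, ?_⟩
    simp only [Pi.sub_apply (δ⁻¹ • (f δ - f₀)) v]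
    rw [intervalIntegral.integral_sub (hq.continuous.intervalIntegrable 0 1)
      (hv.continuous.intervalIntegrable 0 1), hv0, hfδ'.integral_smul_sub hf₀', sub_zero]
  · filter_upwards [h.tendstoCk_slope_liftTransfer hf₀ _ (half_pos hc),
      h.tendstoCk_liftTransfer hv _ (half_pos hc), h.lift, hf] with δ hD hLv hδ ⟨_, hfδ⟩
    have hslope := ((hL hδ hf₀1).sub (hL h.base hf₀1)).const_smul δ⁻¹
    have hsum := hD.add hLv (hslope.sub (h.base.periodicCk_liftDerivOp le_rfl
      h.periodicCk hf₀)).contDiff ((hL hδ hv).sub (hL h.base hv)).contDiff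
    rw [add_halves] at hsum
    convert hsum using 1
    rw [← smul_sub_sub_liftTransfer hfδ.fixed hf₀'.fixed, ← hvg, map_sub]
    abel

end LiftFamily

/-! ### From the circle to the line -/

/-- A function on the circle, seen as a `1`-periodic function on the line. -/
def toLine (f : X → ℝ) (t : ℝ) : ℝ := f (t : X)

section ToLine

variable {k : ℕ} {f g : X → ℝ}

theorem toLine_periodic (f : X → ℝ) : Function.Periodic (toLine f) 1 := fun t => by simp [toLine]

theorem forall_coe {p : X → Prop} : (∀ x, p x) ↔ ∀ t : ℝ, p t :=
  QuotientAddGroup.mk_surjective.forall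

theorem toLine_injective : Function.Injective toLine := fun _ _ h =>
  funext (forall_coe.2 (congrFun h))

theorem exists_toLine_eq {v : ℝ → ℝ} (hv : Function.Periodic v 1) : ∃ f : X → ℝ, toLine f = v :=
  ⟨hv.lift, funext fun t => hv.lift_coe t⟩

theorem continuous_toLine_iff : Continuous (toLine f) ↔ Continuous f :=
  continuous_coinduced_dom.symm

theorem periodicCk_zero_toLine (hf : Continuous f) : PeriodicCk 0 (toLine f) :=
  ⟨contDiff_zero.2 (continuous_toLine_iff.2 hf), toLine_periodic f⟩

theorem IsCk.periodicCk (hf : IsCk k f) : PeriodicCk k (toLine f) := ⟨hf, toLine_periodic f⟩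

theorem IsCk.of_le {l : ℕ} (hf : IsCk k f) (h : l ≤ k) : IsCk l f :=
  (hf.periodicCk.of_le h).contDiff

theorem toLine_sum {ι : Type*} (s : Finset ι) (u : ι → X → ℝ) :
    toLine (fun x => ∑ i ∈ s, u i x) = ∑ i ∈ s, toLine (u i) :=
  funext fun t => (Finset.sum_apply t s fun i => toLine (u i)).symm

theorem integral_toLine (f : X → ℝ) : ∫ t in (0 : ℝ)..1, toLine f t = ∫ x : X, f x := by
  have h := UnitAddCircle.intervalIntegral_preimage 0 f
  rw [zero_add] at h
  exact h

theorem toLine_fderivX (f : X → ℝ) : toLine (fderivX f) = deriv (toLine f) := by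
  funext t
  have h := deriv_comp_const_add (f := toLine f) t 0
  rw [add_zero] at h
  simp only [← h, toLine, fderivX, AddCircle.coe_add]

theorem toLine_iterate_fderivX (f : X → ℝ) (k : ℕ) :
    toLine (fderivX^[k] f) = iteratedDeriv k (toLine f) := by
  induction k with
  | zero => rw [Function.iterate_zero_apply, iteratedDeriv_zero]
  | succ k ih => rw [Function.iterate_succ_apply', toLine_fderivX, ih, iteratedDeriv_succ]

theorem IsCk.ckBound_c3Norm (hf : IsCk 3 f) : CkBound 3 (c3Norm f) (toLine f) := fun k hk t => by
  obtain ⟨M, hM⟩ := hf.periodicCk.exists_ckBound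
  have hbdd : BddAbove (range fun x : X => |fderivX^[k] f x|) := by
    refine ⟨M, forall_mem_range.2 (forall_coe.2 fun t => ?_)⟩
    have hMt := hM k hk t
    rwa [← toLine_iterate_fderivX] at hMt
  rw [← toLine_iterate_fderivX]
  exact (le_ciSup hbdd (t : X)).trans <|
    Finset.single_le_sum (f := fun k => ⨆ x : X, |fderivX^[k] f x|)
      (fun _ _ => Real.iSup_nonneg fun _ => abs_nonneg _)
        (Finset.mem_range.2 (Nat.lt_succ_of_le hk))

theorem IsW11.continuous (hf : IsW11 f) : Continuous f := by
  have hcont : ContinuousOn (toLine f) (uIcc 0 1) :=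
    AbsolutelyContinuousOnInterval.continuousOn hf
  rw [uIcc_of_le zero_le_one, ← zero_add (1 : ℝ)] at hcont
  have hlift : AddCircle.liftIco (1 : ℝ) 0 (toLine f) = f :=
    funext fun x => congrArg f AddCircle.coe_equivIco
  exact hlift ▸ AddCircle.liftIco_continuous (toLine_periodic f 0).symm hcont

theorem IsCk.isW11 (hf : IsCk 1 f) : IsW11 f :=
  ContDiffOn.absolutelyContinuousOnInterval (ContDiff.contDiffOn hf)

theorem w11Norm_nonneg (f : X → ℝ) : 0 ≤ w11Norm f :=
  add_nonneg (integral_nonneg fun _ => abs_nonneg _) (integral_nonneg fun _ => abs_nonneg _)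

theorem integral_abs_le {c : ℝ} (hf : ∀ t, |toLine f t| ≤ c) : ∫ x : X, |f x| ≤ c := by
  have hnorm := norm_integral_le_of_norm_le_const (μ := (volume : Measure X))
    (f := fun x => |f x|) (.of_forall (forall_coe.2 fun t => (abs_abs (f t)).trans_le (hf t)))
  simp only [measureReal_def, UnitAddCircle.measure_univ, ENNReal.toReal_one, mul_one] at hnorm
  exact (le_abs_self _).trans hnorm

theorem w11Norm_le {c : ℝ} (hf : CkBound 1 c (toLine f)) : w11Norm f ≤ 2 * c := by
  obtain ⟨hf0, hf1⟩ := ckBound_one_iff.1 hf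
  rw [← toLine_fderivX] at hf1
  rw [w11Norm, two_mul]
  exact add_le_add (integral_abs_le hf0) (integral_abs_le hf1)

theorem tendstoW11_of_tendstoCk {ι : Type*} {l : Filter ι} {u : ι → X → ℝ}
    (hu : ∀ᶠ i in l, IsCk 1 (u i)) (hf : IsCk 1 f)
    (h : TendstoCk 1 (fun i => toLine (u i)) l (toLine f)) : TendstoW11 u l f := by
  refine ⟨hu.mono fun i hi => hi.isW11, hf.isW11, Metric.tendsto_nhds.2 fun c hc => ?_⟩
  filter_upwards [h (c / 4) (by linarith)] with i hi
  rw [Real.dist_eq, sub_zero, abs_of_nonneg (w11Norm_nonneg _)]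
  exact (w11Norm_le (f := u i - f) hi).trans_lt (by linarith)

end ToLine

/-! ### Lifts of circle maps -/

/-- `F` is a lift of the circle map `T`, and an expanding lift of degree `d`. -/
structure IsLift (d : ℕ) (F : ℝ → ℝ) (T : X → X) : Prop extends ExpandingLift d F where
  coe : ∀ t : ℝ, T (t : X) = (F t : X)

theorem coe_eq_coe_iff {s t : ℝ} : (s : X) = (t : X) ↔ ∃ n : ℤ, s = t + n := by
  rw [← sub_eq_zero, ← AddCircle.coe_sub, AddCircle.coe_eq_zero_iff]
  simp only [zsmul_eq_mul, mul_one]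
  exact exists_congr fun n => ⟨fun h => by linarith, fun h => by linarith⟩

theorem exists_int_apply_add_one {F : ℝ → ℝ} (hF : Continuous F)
    (h : ∀ t, (F (t + 1) : X) = (F t : X)) : ∃ n : ℤ, ∀ t, F (t + 1) = F t + n := by
  choose n hn using fun t => coe_eq_coe_iff.1 (h t)
  have hcoe : (fun m : ℤ => (m : ℝ)) ∘ n = fun t => F (t + 1) - F t :=
    funext fun t => (sub_eq_of_eq_add' (hn t)).symm
  have hcont : Continuous n := by
    rw [Int.isClosedEmbedding_coe_real.isEmbedding.continuous_iff, hcoe]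
    fun_prop
  exact ⟨n 0, fun t => PreconnectedSpace.constant inferInstance hcont (x := t) (y := 0) ▸ hn t⟩

namespace IsExpandingC3

variable {T : X → X}

theorem one_lt_deriv (hT : IsExpandingC3 T) {F : ℝ → ℝ} (hF : Continuous F)
    (h : ∀ t : ℝ, T (t : X) = (F t : X)) (t : ℝ) : 1 < deriv F t :=
  mapDeriv_of_lift h t hF.continuousAt ▸ hT.expanding t

theorem exists_isLift (hT : IsExpandingC3 T) : ∃ d F, IsLift d F T := by
  obtain ⟨F, hF, hcoe⟩ := hT.smooth
  have hderiv := hT.one_lt_deriv hF.continuous hcoe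
  obtain ⟨n, hn⟩ := exists_int_apply_add_one hF.continuous fun t => by simp [← hcoe]
  have hmono : StrictMono F := strictMono_of_deriv_pos fun t => one_pos.trans (hderiv t)
  have hpos : (0 : ℝ) < n := by linarith [hn 0, hmono (lt_add_one 0)]
  lift n to ℕ using (by exact_mod_cast hpos.le)
  exact ⟨n, F, ⟨hF, by simpa using hn, hderiv⟩, hcoe⟩

end IsExpandingC3

namespace IsLift

variable {d : ℕ} {F : ℝ → ℝ} {T : X → X}

theorem toLine_mapDeriv (h : IsLift d F T) : toLine (mapDeriv T) = deriv F :=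
  funext fun t => mapDeriv_of_lift h.coe t h.contDiff.continuous.continuousAt

theorem continuous_map (h : IsLift d F T) : Continuous T := by
  refine continuous_coinduced_dom.2 ?_
  have hcomp : T ∘ (fun t : ℝ => (t : X)) = fun t => (F t : X) := funext h.coe
  exact hcomp ▸ (AddCircle.continuous_mk' 1).comp h.contDiff.continuous

theorem apply_add_intCast (h : IsLift d F T) (t : ℝ) (n : ℤ) : F (t + n) = F t + n * d := by
  have hper : Function.Periodic (fun t => F t - d * t) 1 := fun t => by
    simp only [h.add_one]; ring
  have hn := hper.int_mul n t
  simp only [mul_one] at hn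
  linarith

theorem coe_invLift_eq_iff (h : IsLift d F T) {x y : ℝ} :
    (invLift F x : X) = (invLift F y : X) ↔ ∃ n : ℤ, x = y + n * d := by
  refine coe_eq_coe_iff.trans (exists_congr fun n => ?_)
  rw [← h.strictMono.injective.eq_iff, h.apply_add_intCast, h.apply_invLift, h.apply_invLift]

theorem preimage_eq (h : IsLift d F T) (x : ℝ) :
    T ⁻¹' {(x : X)} = (fun i : ℕ => ((invLift F (x + i) : ℝ) : X)) '' Finset.range d := by
  have hd : (0 : ℤ) < d := by exact_mod_cast h.degree_pos
  ext y
  revert y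
  refine forall_coe.2 fun s => ⟨fun hs => ?_, ?_⟩
  · obtain ⟨m, hm⟩ := coe_eq_coe_iff.1 ((h.coe s).symm.trans hs)
    obtain ⟨i, hi⟩ := Int.eq_ofNat_of_zero_le (Int.emod_nonneg m hd.ne')
    have hid : i < d := by exact_mod_cast hi ▸ Int.emod_lt_of_pos m hd
    have hm' : F s = x + i + (m / d : ℤ) * d := by
      have hdiv := Int.emod_add_mul_ediv m d
      rw [hi] at hdiv
      have hdiv' : (i : ℝ) + d * (m / d : ℤ) = m := by exact_mod_cast hdiv
      rw [hm, ← hdiv']; ring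
    refine ⟨i, by simpa using hid, Eq.symm (coe_eq_coe_iff.2 ⟨m / d, ?_⟩)⟩
    rw [← h.strictMono.injective.eq_iff, h.apply_add_intCast, h.apply_invLift, hm']
  · rintro ⟨i, -, hi⟩
    rw [mem_preimage, ← hi, h.coe, h.apply_invLift]
    exact coe_eq_coe_iff.2 ⟨i, by simp⟩

theorem injOn_branch (h : IsLift d F T) (x : ℝ) :
    InjOn (fun i : ℕ => ((invLift F (x + i) : ℝ) : X)) (Finset.range d) := by
  intro i hi j hj hij
  obtain ⟨n, hn⟩ := h.coe_invLift_eq_iff.1 hij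
  have hmod : i ≡ j [MOD d] := by
    refine Int.natCast_modEq_iff.1 (Int.modEq_iff_dvd.2 ⟨-n, ?_⟩)
    have : (j : ℝ) - i = d * -n := by linarith
    exact_mod_cast this
  exact hmod.eq_of_lt_of_lt (by simpa using hi) (by simpa using hj)

theorem toLine_transfer (h : IsLift d F T) (f : X → ℝ) :
    toLine (transfer T f) = liftTransfer d F (toLine f) := by
  funext x
  have hderiv (t : ℝ) : mapDeriv T (t : X) = deriv F t := congrFun h.toLine_mapDeriv t
  rw [toLine, transfer, h.preimage_eq, finsum_mem_image (h.injOn_branch x), finsum_mem_coe_finset,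
    liftTransfer_eq_branchSum, branchSum_apply]
  refine Finset.sum_congr rfl fun i _ => ?_
  rw [hderiv, abs_of_pos (h.deriv_pos _), div_eq_mul_inv]
  rfl

theorem toLine_iterate_transfer (h : IsLift d F T) (f : X → ℝ) (n : ℕ) :
    toLine ((transfer T)^[n] f) = (liftTransfer d F ^ n) (toLine f) := by
  induction n with
  | zero => rfl
  | succ n ih =>
    rw [Function.iterate_succ_apply', h.toLine_transfer, ih, pow_succ', Module.End.mul_apply]

theorem continuous_transfer (h : IsLift d F T) {f : X → ℝ} (hf : Continuous f) :
    Continuous (transfer T f) := by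
  rw [← continuous_toLine_iff, h.toLine_transfer]
  exact (h.periodicCk_liftTransfer zero_le_two (periodicCk_zero_toLine hf)).continuous

theorem integral_mul_transfer (h : IsLift d F T) {f φ : X → ℝ} (hf : Continuous f)
    (hφ : Continuous φ) : ∫ x : X, φ x * transfer T f x = ∫ x : X, φ (T x) * f x := by
  have hline := h.integral_mul_liftTransfer (periodicCk_zero_toLine hφ) (periodicCk_zero_toLine hf)
  rw [← h.toLine_transfer] at hline
  rw [← integral_toLine, ← integral_toLine]
  simpa only [toLine, h.coe] using hline

theorem toLine_derivOp (h : IsLift d F T) {ε w : X → ℝ} (hε : IsCk 1 ε) (hw : IsCk 1 w) :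
    toLine (derivOp T ε w) = liftDerivOp d F (toLine ε) (toLine w) := by
  have he := hε.periodicCk.differentiable
  have hw' := hw.periodicCk.differentiable
  have hwt := h.periodicCk_weight.differentiable
  have hsum : toLine (derivOp T ε w) =
      -toLine (transfer T fun y => w y * fderivX ε y / mapDeriv T y)
      - toLine (transfer T fun y => ε y * fderivX w y / mapDeriv T y)
      + toLine (transfer T fun y => ε y * fderivX (mapDeriv T) y / mapDeriv T y ^ 2 * w y) := rfl
  rw [hsum, h.toLine_transfer, h.toLine_transfer, h.toLine_transfer, liftDerivOp,
    h.deriv_liftTransfer (he.mul hw'), ← map_neg, ← map_neg, ← map_sub, ← map_add]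
  congr 1
  funext t
  have hderiv := (((he t).hasDerivAt.mul (hw' t).hasDerivAt).mul (hwt t).hasDerivAt).deriv
  have hε' := congrFun (toLine_fderivX ε) t
  have hw' := congrFun (toLine_fderivX w) t
  have hT := congrFun h.toLine_mapDeriv t
  have hT' := congrFun (toLine_fderivX (mapDeriv T)) t
  rw [h.toLine_mapDeriv] at hT'
  simp only [toLine] at hε' hw' hT hT'
  rw [Pi.neg_apply, hderiv, h.deriv_weight, ← toLine_fderivX, ← toLine_fderivX]
  simp only [Pi.neg_apply, Pi.add_apply, Pi.sub_apply, Pi.mul_apply, Pi.pow_apply, weight,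
    Pi.inv_apply, toLine, hT, hT', div_eq_mul_inv, inv_pow]
  ring

theorem isCk_derivOp (h : IsLift d F T) {ε w : X → ℝ} (hε : IsCk 2 ε) (hw : IsCk 2 w) :
    IsCk 1 (derivOp T ε w) := by
  have hline := h.periodicCk_liftDerivOp le_rfl hε.periodicCk hw.periodicCk
  rw [← h.toLine_derivOp (hε.of_le one_le_two) (hw.of_le one_le_two)] at hline
  exact hline.contDiff

theorem integral_derivOp (h : IsLift d F T) {ε w : X → ℝ} (hε : IsCk 1 ε) (hw : IsCk 1 w) :
    ∫ x : X, derivOp T ε w x = 0 := by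
  rw [← integral_toLine, h.toLine_derivOp hε hw]
  exact h.integral_liftDerivOp hε.periodicCk hw.periodicCk

end IsLift

/-! ### Invariant densities -/

section Density

variable {f φ : X → ℝ}

theorem integrable_of_continuous (hf : Continuous f) : Integrable f (volume : Measure X) :=
  hf.integrable_of_hasCompactSupport (.of_compactSpace f)

theorem eq_zero_of_integral_mul_self_eq_zero (hf : Continuous f)
    (h : ∫ x : X, f x * f x = 0) : f = 0 := by
  have hff : Continuous fun x => f x * f x := hf.mul hf
  rw [integral_eq_zero_iff_of_nonneg (fun x => mul_self_nonneg (f x))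
    (integrable_of_continuous hff), hff.ae_eq_iff_eq volume continuous_zero] at h
  exact funext fun x => mul_self_eq_zero.1 (congrFun h x)

/-- The measure `f m` with density `f`. -/
noncomputable abbrev densityMeasure (f : X → ℝ) : Measure X :=
  volume.withDensity fun x => ENNReal.ofReal (f x)

theorem integral_densityMeasure (hf : Continuous f) (h0 : ∀ x, 0 ≤ f x) (φ : X → ℝ) :
    ∫ x, φ x ∂densityMeasure f = ∫ x : X, φ x * f x := by
  rw [integral_withDensity_eq_integral_toReal_smul hf.measurable.ennreal_ofReal
    (.of_forall fun _ => ENNReal.ofReal_lt_top)]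
  simp only [ENNReal.toReal_ofReal (h0 _), smul_eq_mul, mul_comm]

end Density

namespace IsLift

variable {d : ℕ} {F : ℝ → ℝ} {T : X → X} {f : X → ℝ}

theorem integral_comp_densityMeasure (h : IsLift d F T) (hf : Continuous f) (h0 : ∀ x, 0 ≤ f x)
    {φ : X → ℝ} (hφ : Continuous φ) :
    ∫ x, φ (T x) ∂densityMeasure f = ∫ x : X, φ x * transfer T f x := by
  rw [integral_densityMeasure hf h0, h.integral_mul_transfer hf hφ]

theorem transfer_eq_of_measurePreserving (h : IsLift d F T) (hf : Continuous f)
    (h0 : ∀ x, 0 ≤ f x) (hT : MeasurePreserving T (densityMeasure f) (densityMeasure f)) :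
    transfer T f = f := by
  have hLf := h.continuous_transfer hf
  have hg : Continuous (transfer T f - f) := hLf.sub hf
  have hmap := integral_map hT.measurable.aemeasurable
    (hg.aestronglyMeasurable (μ := (densityMeasure f).map T))
  rw [hT.map_eq, h.integral_comp_densityMeasure hf h0 hg, integral_densityMeasure hf h0] at hmap
  have hint {φ : X → ℝ} (hφ : Continuous φ) :
      Integrable (fun x => (transfer T f - f) x * φ x) (volume : Measure X) :=
    integrable_of_continuous (hg.mul hφ)
  refine sub_eq_zero.1 (eq_zero_of_integral_mul_self_eq_zero hg ?_)
  calc ∫ x, (transfer T f - f) x * (transfer T f - f) x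
      = ∫ x, ((transfer T f - f) x * transfer T f x - (transfer T f - f) x * f x) := by
        simp only [← mul_sub, Pi.sub_apply]
    _ = 0 := by
        rw [integral_sub (hint hLf) (hint hf), hmap, sub_self]

theorem measurePreserving_of_transfer_eq (h : IsLift d F T) (hf : Continuous f)
    (h0 : ∀ x, 0 ≤ f x) (hT : transfer T f = f) :
    MeasurePreserving T (densityMeasure f) (densityMeasure f) := by
  have hTm := h.continuous_map.measurable
  have : IsFiniteMeasure (densityMeasure f) :=
    isFiniteMeasure_withDensity_ofReal (integrable_of_continuous hf).2
  refine ⟨hTm, ext_of_forall_integral_eq_of_IsFiniteMeasure fun φ => ?_⟩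
  rw [integral_map hTm.aemeasurable φ.continuous.aestronglyMeasurable,
    h.integral_comp_densityMeasure hf h0 φ.continuous, hT, integral_densityMeasure hf h0]

theorem isInvariantDensity_iff (h : IsLift d F T) :
    IsInvariantDensity T f ↔ IsW11 f ∧ IsFixedDensity d F (toLine f) := by
  have hfix : transfer T f = f ↔ liftTransfer d F (toLine f) = toLine f := by
    rw [← toLine_injective.eq_iff, h.toLine_transfer]
  constructor
  · rintro ⟨hW, h0, h1, hT⟩
    exact ⟨hW, periodicCk_zero_toLine hW.continuous, fun t => h0 t, (integral_toLine f).trans h1,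
      hfix.1 (h.transfer_eq_of_measurePreserving hW.continuous h0 hT)⟩
  · rintro ⟨hW, _, h0, h1, hL⟩
    have h0' := (forall_coe (p := fun x => 0 ≤ f x)).2 h0
    exact ⟨hW, h0', (integral_toLine f).symm.trans h1,
      h.measurePreserving_of_transfer_eq hW.continuous h0' (hfix.2 hL)⟩

theorem exists_isInvariantDensity (h : IsLift d F T) : ∃ f, IsCk 2 f ∧ IsInvariantDensity T f := by
  obtain ⟨v, hv, -, hvF⟩ := h.exists_pos_isFixedDensity
  obtain ⟨f, rfl⟩ := exists_toLine_eq hv.periodic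
  have hf : IsCk 2 f := hv.contDiff
  exact ⟨f, hf, h.isInvariantDensity_iff.2 ⟨(hf.of_le one_le_two).isW11, hvF⟩⟩

theorem isCk_iterate_transfer (h : IsLift d F T) {g : X → ℝ} (hg : IsCk 1 g) (n : ℕ) :
    IsCk 1 ((transfer T)^[n] g) := by
  have hline := h.periodicCk_liftTransfer_pow one_le_two hg.periodicCk n
  rw [← h.toLine_iterate_transfer] at hline
  exact hline.contDiff

theorem exists_isResolventAt (h : IsLift d F T) {g : X → ℝ} (hg : IsCk 1 g)
    (hg0 : ∫ x : X, g x = 0) : ∃ w, IsCk 1 w ∧ IsResolventAt T g w := by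
  obtain ⟨a, κ, hcone⟩ := h.exists_strictCone le_rfl one_le_two
  rw [← integral_toLine] at hg0
  have hgCk := hg.periodicCk
  have hN := hcone.periodicCk_neumannSeries hgCk hg0
  obtain ⟨w, hw⟩ := exists_toLine_eq hN.periodic
  have hwCk : IsCk 1 w := (congrArg (ContDiff ℝ 1) hw).mpr hN.contDiff
  have hsolve : w - transfer T w = g := toLine_injective <| by
    have := hcone.neumannSeries_sub_liftTransfer hgCk hg0
    rwa [← hw, ← h.toLine_transfer] at this
  have hsum (n : ℕ) : toLine (fun x => ∑ i ∈ Finset.range n, (transfer T)^[i] g x)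
      = ∑ i ∈ Finset.range n, (liftTransfer d F ^ i) (toLine g) := by
    simp only [← h.toLine_iterate_transfer, toLine_sum]
  refine ⟨w, hwCk, hwCk.isW11, ?_, congrFun hsolve, tendstoW11_of_tendstoCk
    (.of_forall fun n => ContDiff.sum fun i _ => h.isCk_iterate_transfer hg i) hwCk ?_⟩
  · rw [← integral_toLine, hw, hcone.integral_neumannSeries hgCk hg0]
  · simpa only [hsum, hw] using hcone.tendstoCk_neumannSeries hgCk hg0

end IsLift

theorem IsInvariantDensity.eq {T : X → X} {f g : X → ℝ} (hT : IsExpandingC3 T)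
    (hf : IsInvariantDensity T f) (hg : IsInvariantDensity T g) : f = g := by
  obtain ⟨d, F, h⟩ := hT.exists_isLift
  rw [h.isInvariantDensity_iff] at hf hg
  exact toLine_injective (hf.2.eq h.toExpandingLift hg.2)

theorem IsExpandingC3.existsUnique_isInvariantDensity {T : X → X} (hT : IsExpandingC3 T) :
    ∃! f, IsInvariantDensity T f := by
  obtain ⟨d, F, h⟩ := hT.exists_isLift
  obtain ⟨f, -, hf⟩ := h.exists_isInvariantDensity
  exact ⟨f, hf, fun g hg => hg.eq hT hf⟩

theorem IsInvariantDensity.isCk {T : X → X} {f : X → ℝ} (hT : IsExpandingC3 T)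
    (hf : IsInvariantDensity T f) : IsCk 2 f := by
  obtain ⟨d, F, h⟩ := hT.exists_isLift
  obtain ⟨g, hgCk, hg⟩ := h.exists_isInvariantDensity
  exact hg.eq hT hf ▸ hgCk

/-! ### Differentiable families -/

theorem IsLift.add {d : ℕ} {F : ℝ → ℝ} {S T : X → X} {φ : X → ℝ} (h : IsLift d F S)
    (hT : IsExpandingC3 T) (hφ : IsCk 3 φ) (hST : ∀ x, T x = S x + (φ x : X)) :
    IsLift d (F + toLine φ) T := by
  have hcont : ContDiff ℝ 3 (F + toLine φ) := h.contDiff.add hφ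
  have hcoe (t : ℝ) : T t = ((F + toLine φ) t : X) := by
    rw [hST, h.coe, Pi.add_apply, AddCircle.coe_add]
    rfl
  refine ⟨⟨hcont, fun t => ?_, hT.one_lt_deriv hcont.continuous hcoe⟩, hcoe⟩
  rw [Pi.add_apply, Pi.add_apply, h.add_one, toLine_periodic φ t, add_right_comm]

theorem tendstoCk_slope_of_c3Norm {F : ℝ → ℝ} {ε : X → ℝ} {r : ℝ → X → ℝ}
    (hr : ∀ᶠ δ in 𝓝[>] 0, IsCk 3 (r δ)) (hr0 : Tendsto (fun δ => c3Norm (r δ) / δ) (𝓝[>] 0) (𝓝 0)) :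
    TendstoCk 3 (fun δ => δ⁻¹ • (F + toLine (fun x => δ * ε x + r δ x) - F)) (𝓝[>] 0)
      (toLine ε) := by
  intro c hc
  filter_upwards [hr, hr0.eventually_le_const hc, self_mem_nhdsWithin] with δ hδ hδc (hδ0 : 0 < δ)
  have hslope : δ⁻¹ • (F + toLine (fun x => δ * ε x + r δ x) - F) - toLine ε
      = δ⁻¹ • toLine (r δ) := by
    funext t
    simp only [Pi.smul_apply, Pi.sub_apply, Pi.add_apply, smul_eq_mul, toLine]
    field_simp
    ring
  rw [hslope]
  refine (hδ.ckBound_c3Norm.const_smul δ⁻¹).mono ?_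
  rwa [abs_of_pos (inv_pos.2 hδ0), inv_mul_eq_div]

theorem eventually_mem_Ico {η : ℝ} (hη : 0 < η) : ∀ᶠ δ in 𝓝[>] (0 : ℝ), δ ∈ Ico 0 η :=
  mem_of_superset (Ioo_mem_nhdsGT hη) Ioo_subset_Ico_self

namespace IsDifferentiableFamily

variable {η : ℝ} {T : ℝ → X → X} {ε : X → ℝ}

theorem exists_liftFamily (hT : IsDifferentiableFamily η T ε) (hη : 0 < η) {d : ℕ} {F₀ : ℝ → ℝ}
    (h₀ : IsLift d F₀ (T 0)) :
    ∃ F, LiftFamily d F F₀ (toLine ε) ∧ ∀ᶠ δ in 𝓝[>] 0, IsLift d (F δ) (T δ) := by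
  obtain ⟨r, hr, hr0⟩ := hT.expansion
  have hlift : ∀ᶠ δ in 𝓝[>] 0, IsLift d (F₀ + toLine fun x => δ * ε x + r δ x) (T δ) := by
    filter_upwards [hr, eventually_mem_Ico hη] with δ ⟨hrδ, hTδ⟩ hδ
    exact h₀.add (hT.expanding δ hδ)
      ((hT.smooth.periodicCk.const_smul δ).add hrδ.periodicCk).contDiff hTδ
  exact ⟨_, ⟨h₀.toExpandingLift, hlift.mono fun _ h => h.toExpandingLift,
    (hT.smooth.of_le (by norm_num)).periodicCk,
    fun c hc => (tendstoCk_slope_of_c3Norm (hr.mono fun _ h => h.1) hr0 c hc).mono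
      fun δ hδ k hk => hδ k (hk.trans (by norm_num))⟩, hlift⟩

theorem tendstoW11_slope (hT : IsDifferentiableFamily η T ε) (hη : 0 < η) {f : ℝ → X → ℝ}
    (hf : ∀ δ ∈ Ico 0 η, IsInvariantDensity (T δ) (f δ)) {h : X → ℝ} (hh : IsCk 1 h)
    (hres : IsResolventAt (T 0) (derivOp (T 0) ε (f 0)) h) :
    TendstoW11 (fun δ x => (f δ x - f 0 x) / δ) (𝓝[>] 0) h := by
  have h0η : (0 : ℝ) ∈ Ico 0 η := left_mem_Ico.2 hη
  have hf2 {δ : ℝ} (hδ : δ ∈ Ico 0 η) : IsCk 2 (f δ) := (hf δ hδ).isCk (hT.expanding δ hδ)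
  have hf1 {δ : ℝ} (hδ : δ ∈ Ico 0 η) : IsCk 1 (f δ) := (hf2 hδ).of_le one_le_two
  obtain ⟨d, F₀, h₀⟩ := (hT.expanding 0 h0η).exists_isLift
  obtain ⟨F, hF, hlift⟩ := hT.exists_liftFamily hη h₀
  have hslope (δ : ℝ) : toLine (fun x => (f δ x - f 0 x) / δ)
      = δ⁻¹ • (toLine (f δ) - toLine (f 0)) := funext fun t => div_eq_inv_mul _ _
  have hsolve : toLine h - liftTransfer d F₀ (toLine h)
      = liftDerivOp d F₀ (toLine ε) (toLine (f 0)) := by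
    rw [← h₀.toLine_transfer, ← h₀.toLine_derivOp (hT.smooth.of_le (by norm_num)) (hf1 h0η),
      ← funext hres.solves]
    rfl
  refine tendstoW11_of_tendstoCk ?_ hh ?_
  · filter_upwards [eventually_mem_Ico hη] with δ hδ
    have hCk := ((hf1 hδ).periodicCk.sub (hf1 h0η).periodicCk).const_smul δ⁻¹
    rw [← hslope] at hCk
    exact hCk.contDiff
  · simp only [hslope]
    refine hF.tendstoCk_slope_isFixedDensity (hf2 h0η).periodicCk
      (h₀.isInvariantDensity_iff.1 (hf 0 h0η)).2 ?_ hh.periodicCk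
      ((integral_toLine h).trans hres.zero_average) hsolve
    filter_upwards [eventually_mem_Ico hη, hlift] with δ hδ hδF
    exact ⟨(hf1 hδ).periodicCk, (hδF.isInvariantDensity_iff.1 (hf δ hδ)).2⟩

end IsDifferentiableFamily

end CircleMap

theorem mainTheorem4 (η : ℝ) (hη : 0 < η) (T : ℝ → X → X) (ε : X → ℝ)
    (hT : CircleMap.IsDifferentiableFamily η T ε) :
    (∀ δ ∈ Set.Ico 0 η, ∃! f : X → ℝ, CircleMap.IsInvariantDensity (T δ) f) ∧
    ∀ f : ℝ → X → ℝ,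
      (∀ δ ∈ Set.Ico 0 η, CircleMap.IsInvariantDensity (T δ) (f δ)) →
      (∀ δ ∈ Set.Ico 0 η, CircleMap.IsCk 2 (f δ)) ∧
      ∃ h : X → ℝ,
        CircleMap.IsResolventAt (T 0) (CircleMap.derivOp (T 0) ε (f 0)) h ∧
        CircleMap.TendstoW11 (fun δ : ℝ => fun x => (f δ x - f 0 x) / δ)
          (nhdsWithin 0 (Set.Ioi 0)) h := by
  open CircleMap in
  refine ⟨fun δ hδ => (hT.expanding δ hδ).existsUnique_isInvariantDensity, fun f hf => ?_⟩
  have hf2 : ∀ δ ∈ Set.Ico 0 η, IsCk 2 (f δ) := fun δ hδ => (hf δ hδ).isCk (hT.expanding δ hδ)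
  have h0 : (0 : ℝ) ∈ Set.Ico 0 η := Set.left_mem_Ico.2 hη
  obtain ⟨d, F, hF⟩ := (hT.expanding 0 h0).exists_isLift
  have hε : IsCk 2 ε := hT.smooth.of_le (by norm_num)
  obtain ⟨h, hh, hres⟩ := hF.exists_isResolventAt (hF.isCk_derivOp hε (hf2 0 h0))
    (hF.integral_derivOp (hε.of_le one_le_two) ((hf2 0 h0).of_le one_le_two))
  exact ⟨hf2, h, hres, hT.tendstoW11_slope hη hf hh hres⟩
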